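/- Let $a,d\in\mathbb C$, and write $\vartheta_x=x\,\partial/\partial x$, $\vartheta_y=y\,\partial/\partial y$. Let $f(x,y)$ be a complex-valued $C^2$ function on the quadrant $x>0$, $y<0$ which solves there the system of Horn's function $\mathrm H_{10}(a,d;x,y)=\sum_{m,n\ge 0}\frac{(a)_{2m-n}}{(d)_m\,m!\,n!}x^my^n$, that is, \[ \{x(2\vartheta_x-\vartheta_y+a)(2\vartheta_x-\vartheta_y+a+1)-\vartheta_x(\vartheta_x+d-1)\}f=0,\qquad \{y-\vartheta_y(2\vartheta_x-\vartheta_y+a)\}f=0 . \] Suppose that \[ \sup_{x,y>0}\,|y^{\alpha_1}x^{\alpha_2}f(x,-y)|<\infty \] for all $\alpha_1,\alpha_2\in\mathbb N$ for which $\alpha_2$ and $\alpha_1-2\alpha_2$ are sufficiently large (that is, there is $N\in\mathbb N$ such that this holds whenever $\alpha_2\ge N$ and $\alpha_1\ge 2\alpha_2+N$). Then there is a constant $C\in\mathbb C$ such that, for all $\sigma_1,\sigma_2\in\mathbb R$ with $\sigma_1>0$, $\sigma_2>\max\{0,\mathrm{Re}(d-1)\}$, $\sigma_1-2\sigma_2>-\mathrm{Re}(a)$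 and all $x>0$, $y<0$, \[ f(x,y)=C\int_{\sigma_1-\sqrt{-1}\infty}^{\sigma_1+\sqrt{-1}\infty}\int_{\sigma_2-\sqrt{-1}\infty}^{\sigma_2+\sqrt{-1}\infty}\Gamma(s_1)\Gamma(s_1-2s_2+a)\Gamma(s_2)\Gamma(s_2-d+1)(-y)^{-s_1}x^{-s_2}\,ds_1\,ds_2 , \] where the double integral converges absolutely. -/

import Mathlib

open MeasureTheory

noncomputable section

namespace HornH10

/-- The Euler operator `ϑ_x = x ∂/∂x` in the first real variable. -/
def thetaX (f : ℝ × ℝ → ℂ) : ℝ × ℝ → ℂ :=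
  fun p => (p.1 : ℂ) * deriv (fun t : ℝ => f (t, p.2)) p.1

/-- The Euler operator `ϑ_y = y ∂/∂y` in the second real variable. -/
def thetaY (f : ℝ × ℝ → ℂ) : ℝ × ℝ → ℂ :=
  fun p => (p.2 : ℂ) * deriv (fun t : ℝ => f (p.1, t)) p.2

/-- The first-order operator `2ϑ_x - ϑ_y + c`. -/
def opL (c : ℂ) (f : ℝ × ℝ → ℂ) : ℝ × ℝ → ℂ :=
  fun p => 2 * thetaX f p - thetaY f p + c * f p

/-- The first-order operator `ϑ_x + c`. -/
def opX (c : ℂ) (f : ℝ × ℝ → ℂ) : ℝ × ℝ → ℂ :=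
  fun p => thetaX f p + c * f p

/-- `f` is a (classical) solution on `U` of the system of partial differential equations of
Horn's function `H₁₀(a, d; x, y) = ∑ (a)_{2m-n} / ((d)_m m! n!) x^m y^n`. -/
structure IsSolution (a d : ℂ) (U : Set (ℝ × ℝ)) (f : ℝ × ℝ → ℂ) : Prop where
  /-- `f` is twice continuously differentiable on `U`. -/
  contDiffOn : ContDiffOn ℝ 2 f U
  /-- `{x (2ϑ_x - ϑ_y + a) (2ϑ_x - ϑ_y + a + 1) - ϑ_x (ϑ_x + d - 1)} f = 0` on `U`. -/
  eq_x : ∀ p ∈ U, (p.1 : ℂ) * opL a (opL (a + 1) f) p - thetaX (opX (d - 1) f) p = 0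
  /-- `{y - ϑ_y (2ϑ_x - ϑ_y + a)} f = 0` on `U`. -/
  eq_y : ∀ p ∈ U, (p.2 : ℂ) * f p - thetaY (opL a f) p = 0

/-- The quadrant `x > 0`, `y < 0`. -/
def quadrant : Set (ℝ × ℝ) := {p | 0 < p.1 ∧ p.2 < 0}

/-- The Mellin–Barnes integrand
`Γ(s₁) Γ(s₁ - 2 s₂ + a) Γ(s₂) Γ(s₂ - d + 1) (-y)^{-s₁} x^{-s₂}`. -/
def mellinBarnesIntegrand (a d : ℂ) (x y : ℝ) (s₁ s₂ : ℂ) : ℂ :=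
  Complex.Gamma s₁ * Complex.Gamma (s₁ - 2 * s₂ + a) * Complex.Gamma s₂ *
    Complex.Gamma (s₂ - d + 1) * ((-y : ℝ) : ℂ) ^ (-s₁) * (x : ℂ) ^ (-s₂)

/-- The point `σ + iτ` of the vertical line `Re s = σ`. -/
def vline (σ τ : ℝ) : ℂ := (σ : ℂ) + (τ : ℂ) * Complex.I

/-- Absolute convergence of the double integral of `F` over the vertical lines
`Re s₁ = σ₁`, `Re s₂ = σ₂`. -/
def VerticalIntegrable (F : ℂ → ℂ → ℂ) (σ₁ σ₂ : ℝ) : Prop :=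
  Integrable (fun τ : ℝ × ℝ => F (vline σ₁ τ.1) (vline σ₂ τ.2)) volume

/-- The double contour integral of `F(s₁, s₂) ds₁ ds₂` over the vertical lines
`Re s₁ = σ₁`, `Re s₂ = σ₂`, both oriented upwards; here `ds₁ ds₂ = i² dτ₁ dτ₂`. -/
def verticalIntegral (F : ℂ → ℂ → ℂ) (σ₁ σ₂ : ℝ) : ℂ :=
  Complex.I ^ 2 * ∫ τ : ℝ × ℝ, F (vline σ₁ τ.1) (vline σ₂ τ.2)

end HornH10

end

/-! In logarithmic coordinates u = log x, v = log(-y), put H(u,v) = f(e^u, -e^v). Its two-sided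
Laplace transform M(s₁,s₂) = ∫ H e^{s₁v + s₂u} is the Mellin transform of f. The growth hypothesis
makes M absolutely convergent, holomorphic along the complex lines needed and bounded on strips,
once Re s₂ and Re(s₁ - 2s₂) are large.

The two equations have constant coefficients in (u,v), up to factors e^u and e^v, so they become
difference equations: M(s₁+1,s₂) = s₁(s₁-2s₂+a) M(s₁,s₂), and a companion one in s₂
(`IsSolution.laplace_add_one_left`, `IsSolution.laplace_add_one_right`). No decay is known for
derivatives of H, so integration by parts goes through dilated cut-offs
(`tendsto_integral_dirOp_dirOp_cutoff`).

The product Γ(s₁)Γ(s₁-2s₂+a)Γ(s₂)Γ(s₂-d+1) solves the same equations. A quotient by Gamma functions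
is therefore periodic, and a periodic function of growth o(e^{2π|Im s|}) is constant. This is
applied in s₁ for fixed s₂, then to the remaining factor c(s₂)
(`exists_eq_const_mul_Gamma_mul_Gamma`, `IsSolution.exists_laplace_eq`). In the second application
the exponential rates add up to exactly 2π, so the lower bound for Γ must have the sharp rate π/2
with a negative power to spare.

Fourier inversion recovers f from M on one pair of lines (`eq_mul_lineIntegral_of_laplace_eq`), and
Cauchy's theorem moves these to any admissible pair (`lineIntegral_eq`). -/

noncomputable section

namespace HornH10

open Complex Set Filter Topology

/-! ### Upper and lower bounds for the Gamma function on vertical strips -/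

/-- An integral `∫ g exp (z B)` depends holomorphically on `z`, at each point where the integrand
stays integrable after multiplication by `exp (ε ‖B‖)`. -/
theorem differentiableAt_integral_mul_cexp {α : Type*} [MeasurableSpace α] {μ : Measure α}
    {g B : α → ℂ} {z₀ : ℂ} {ε : ℝ} (hε : 0 < ε) (hg : AEStronglyMeasurable g μ)
    (hB : AEStronglyMeasurable B μ)
    (hint : Integrable (fun p => ‖g p * cexp (z₀ * B p)‖ * Real.exp (ε * ‖B p‖)) μ) :
    DifferentiableAt ℂ (fun z => ∫ p, g p * cexp (z * B p) ∂μ) z₀ := by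
  have hexp : ∀ z : ℂ, AEStronglyMeasurable (fun p => cexp (z * B p)) μ := fun z =>
    Complex.continuous_exp.comp_aestronglyMeasurable (hB.const_mul z)
  have key := hasDerivAt_integral_of_dominated_loc_of_deriv_le (μ := μ) (𝕜 := ℂ)
    (F := fun z p => g p * cexp (z * B p)) (F' := fun z p => g p * (cexp (z * B p) * B p))
    (x₀ := z₀) (s := Metric.ball z₀ (ε / 2))
    -- Half of ε pays for moving z within the ball; the other half absorbs the factor ‖B p‖ coming
    -- from the derivative.
    (bound := fun p => 2 / ε * (‖g p * cexp (z₀ * B p)‖ * Real.exp (ε * ‖B p‖)))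
    (Metric.ball_mem_nhds _ (by positivity))
    (Eventually.of_forall fun z => hg.mul (hexp z))
    (by
      refine hint.mono (hg.mul (hexp z₀)) (Eventually.of_forall fun p => ?_)
      rw [Real.norm_of_nonneg (by positivity)]
      exact le_mul_of_one_le_right (norm_nonneg _) (Real.one_le_exp (by positivity)))
    (hg.mul ((hexp z₀).mul hB))
    (Eventually.of_forall fun p z hz => by
      have hz' : ‖z - z₀‖ < ε / 2 := by simpa [dist_eq_norm] using hz
      have e1 : cexp (z * B p) = cexp (z₀ * B p) * cexp ((z - z₀) * B p) := by
        rw [← Complex.exp_add]; ring_nf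
      have e2 : ‖cexp ((z - z₀) * B p)‖ ≤ Real.exp (ε / 2 * ‖B p‖) := by
        refine (Complex.norm_exp_le_exp_norm _).trans (Real.exp_le_exp.2 ?_)
        rw [norm_mul]
        gcongr
      have e3 : ‖B p‖ ≤ 2 / ε * Real.exp (ε / 2 * ‖B p‖) := by
        have := Real.add_one_le_exp (ε / 2 * ‖B p‖)
        calc ‖B p‖ = 2 / ε * (ε / 2 * ‖B p‖) := by field_simp
          _ ≤ _ := by gcongr; linarith
      calc ‖g p * (cexp (z * B p) * B p)‖
          = ‖g p * cexp (z₀ * B p)‖ * ‖cexp ((z - z₀) * B p)‖ * ‖B p‖ := by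
            rw [e1]; simp only [norm_mul]; ring
        _ ≤ ‖g p * cexp (z₀ * B p)‖ * Real.exp (ε / 2 * ‖B p‖) *
              (2 / ε * Real.exp (ε / 2 * ‖B p‖)) := by gcongr
        _ = 2 / ε * (‖g p * cexp (z₀ * B p)‖ * Real.exp (ε * ‖B p‖)) := by
            have : Real.exp (ε * ‖B p‖) = Real.exp (ε / 2 * ‖B p‖) * Real.exp (ε / 2 * ‖B p‖) := by
              rw [← Real.exp_add]; ring_nf
            rw [this]; ring)
    (hint.const_mul _)
    (Eventually.of_forall fun p z _ => by
      simpa using ((hasDerivAt_mul_const (B p)).cexp).const_mul (g p))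
  exact key.2.differentiableAt

theorem norm_ofReal_cpow_sub_one {t : ℝ} (ht : 0 < t) (a : ℂ) :
    ‖(t : ℂ) ^ (a - 1)‖ = t ^ (a.re - 1) := by
  rw [Complex.norm_cpow_eq_rpow_re_of_pos ht]; simp

theorem integrableOn_rpow_mul_exp_neg_mul {σ b : ℝ} (hσ : 0 < σ) (hb : 0 < b) :
    IntegrableOn (fun t : ℝ => t ^ (σ - 1) * Real.exp (-b * t)) (Ioi 0) := by
  have := integrableOn_rpow_mul_exp_neg_mul_rpow (p := 1) (s := σ - 1) (b := b) (by linarith)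
    (by norm_num) hb
  simpa using this

theorem aestronglyMeasurable_cpow_sub_one (a : ℂ) :
    AEStronglyMeasurable (fun t : ℝ => (t : ℂ) ^ (a - 1)) (volume.restrict (Ioi 0)) := by
  refine ContinuousOn.aestronglyMeasurable (fun t ht => ?_) measurableSet_Ioi
  exact ((continuousAt_ofReal_cpow_const t _ (Or.inr (ne_of_gt ht))).continuousWithinAt)

/-- The rotated form of Euler's integral: the parameter `r` is complex. -/
theorem integral_cpow_mul_cexp_neg_mul {a r : ℂ} (ha : 0 < a.re) (hr : 0 < r.re) :
    ∫ t : ℝ in Ioi 0, (t : ℂ) ^ (a - 1) * cexp (r * -(t : ℂ)) = (1 / r) ^ a * Gamma a := by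
  have hopen : IsOpen {z : ℂ | 0 < z.re} := isOpen_lt continuous_const Complex.continuous_re
  have hd1 : DifferentiableOn ℂ
      (fun z : ℂ => ∫ t : ℝ in Ioi 0, (t : ℂ) ^ (a - 1) * cexp (z * -(t : ℂ)))
      {z : ℂ | 0 < z.re} := by
    intro z hz
    have hz : 0 < z.re := hz
    refine (differentiableAt_integral_mul_cexp (ε := z.re / 2) (by positivity)
      (aestronglyMeasurable_cpow_sub_one a) (by fun_prop) ?_).differentiableWithinAt
    refine (integrableOn_rpow_mul_exp_neg_mul ha (b := z.re / 2) (by positivity)).congr_fun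
      (fun t ht => ?_) measurableSet_Ioi
    have ht : 0 < t := ht
    simp only [norm_mul, norm_ofReal_cpow_sub_one ht, Complex.norm_exp, norm_neg, norm_real,
      Real.norm_of_nonneg ht.le]
    rw [mul_assoc, ← Real.exp_add]
    congr 2
    simp
    ring
  have hd2 : DifferentiableOn ℂ (fun z : ℂ => (1 / z) ^ a * Gamma a) {z : ℂ | 0 < z.re} := by
    intro z hz
    have hz : 0 < z.re := hz
    have hz0 : z ≠ 0 := by rintro rfl; simp at hz
    refine DifferentiableAt.differentiableWithinAt ?_
    refine DifferentiableAt.mul_const ?_ _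
    refine DifferentiableAt.cpow_const (by fun_prop (disch := assumption)) (Or.inl ?_)
    rw [one_div, Complex.inv_re]
    have := Complex.normSq_pos.2 hz0
    positivity
  have h := (hd1.analyticOnNhd hopen).eqOn_of_preconnected_of_frequently_eq
    (hd2.analyticOnNhd hopen) (convex_halfSpace_re_gt 0).isPreconnected (z₀ := 1) (by simp) ?_
  · exact h hr
  -- Both sides agree at positive real r by Euler's integral, and these points accumulate at 1.
  · have hfr : ∃ᶠ x : ℝ in 𝓝[≠] (1 : ℝ), 0 < x :=
      (eventually_nhdsWithin_of_eventually_nhds (lt_mem_nhds one_pos)).frequently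
    have ht : Tendsto (fun x : ℝ => (x : ℂ)) (𝓝[≠] 1) (𝓝[≠] 1) := by
      refine tendsto_nhdsWithin_iff.2 ⟨?_, ?_⟩
      · exact (Complex.continuous_ofReal.tendsto' 1 1 (by simp)).mono_left nhdsWithin_le_nhds
      · filter_upwards [self_mem_nhdsWithin] with x hx
        simpa using hx
    refine ht.frequently (hfr.mono fun x hx => ?_)
    have := Complex.integral_cpow_mul_exp_neg_mul_Ioi ha hx
    simpa using this

/-- Rotating the ray of integration by `θ` bounds the Gamma function off the real axis. -/
theorem norm_Gamma_mul_exp_le {a : ℂ} (ha : 0 < a.re) {θ : ℝ} (hθ : |θ| < Real.pi / 2) :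
    ‖Gamma a‖ * Real.exp (θ * a.im) ≤ (1 / Real.cos θ) ^ a.re * Real.Gamma a.re := by
  have hpi := Real.pi_pos
  have hθ' := abs_lt.1 hθ
  have hcos : 0 < Real.cos θ := Real.cos_pos_of_mem_Ioo ⟨by linarith [hθ'.1], hθ'.2⟩
  set r : ℂ := cexp (θ * I) with hr
  have hre : r.re = Real.cos θ := by rw [hr, Complex.exp_ofReal_mul_I_re]
  have hmain := integral_cpow_mul_cexp_neg_mul ha (r := r) (by rw [hre]; exact hcos)
  have hpow : ‖(1 / r) ^ a‖ = Real.exp (θ * a.im) := by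
    have h1 : (1 / r) = cexp (((-θ : ℝ) : ℂ) * I) := by
      rw [hr, one_div, ← Complex.exp_neg]; push_cast; ring_nf
    have h2 : Complex.log (1 / r) = ((-θ : ℝ) : ℂ) * I := by
      rw [h1, Complex.log_exp] <;> simp <;> linarith [hθ'.1, hθ'.2]
    have h0 : (1 / r) ≠ 0 := by rw [h1]; exact Complex.exp_ne_zero _
    rw [Complex.cpow_def_of_ne_zero h0, h2, Complex.norm_exp]
    congr 1
    simp
  have hb := norm_integral_le_integral_norm (μ := volume.restrict (Ioi (0 : ℝ)))
    (fun t : ℝ => (t : ℂ) ^ (a - 1) * cexp (r * -(t : ℂ)))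
  rw [hmain, norm_mul, hpow] at hb
  have hr2 := Real.integral_rpow_mul_exp_neg_mul_Ioi ha hcos
  rw [mul_comm, ← hr2]
  refine hb.trans (le_of_eq (setIntegral_congr_fun measurableSet_Ioi fun t ht => ?_))
  have ht : 0 < t := ht
  simp only [norm_mul, norm_ofReal_cpow_sub_one ht, Complex.norm_exp]
  congr 2
  simp [hre]

theorem norm_Gamma_le_of_re_pos {a : ℂ} (ha : 0 < a.re) : ‖Gamma a‖ ≤ Real.Gamma a.re := by
  simpa using norm_Gamma_mul_exp_le ha (θ := 0) (by simp [Real.pi_pos])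

theorem exists_Gamma_le_Icc {A : ℝ} (hA : 0 < A) (B : ℝ) :
    ∃ C : ℝ, 0 < C ∧ ∀ σ ∈ Icc A B, Real.Gamma σ ≤ C := by
  have hc : ContinuousOn Real.Gamma (Icc A B) := fun x hx =>
    (Real.differentiableAt_Gamma fun m hm => by
      have : (0 : ℝ) ≤ m := Nat.cast_nonneg m
      linarith [hx.1]).continuousAt.continuousWithinAt
  obtain ⟨C, hC⟩ := (isCompact_Icc.bddAbove_image hc)
  refine ⟨max C 1, by positivity, fun σ hσ => ?_⟩
  exact (hC (mem_image_of_mem _ hσ)).trans (le_max_left _ _)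

/-- Each use of the functional equation gains a factor |w + j| ≥ |Im w|; the hypothesis keeps every
w + j away from 0. -/
theorem norm_Gamma_mul_pow_abs_im_le {w : ℂ} (hw : 0 < w.re ∨ w.im ≠ 0) (k : ℕ) :
    ‖Gamma w‖ * |w.im| ^ k ≤ ‖Gamma (w + k)‖ := by
  induction k with
  | zero => simp
  | succ k ih =>
    have hne : w + k ≠ 0 := by
      intro h
      have h1 : w.re + k = 0 := by simpa using congrArg Complex.re h
      have h2 : w.im = 0 := by simpa using congrArg Complex.im h
      have : (0 : ℝ) ≤ k := Nat.cast_nonneg k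
      rcases hw with hw | hw
      · linarith
      · exact hw h2
    have him : |w.im| ≤ ‖w + k‖ := by simpa using Complex.abs_im_le_norm (w + k)
    have hadd : w + ((k + 1 : ℕ) : ℂ) = w + k + 1 := by push_cast; ring
    rw [hadd, Gamma_add_one _ hne, norm_mul, pow_succ, ← mul_assoc, mul_comm]
    gcongr

/-- The ray is rotated by ±(π/2 - 1/|Im s|), with the sign of Im s. Stopping 1/|Im s| short of π/2
costs a factor e in the exponential, while 1/cos of the angle stays below (π/2)|Im s|. The rate π/2
is thus kept, at the price of a power. -/
theorem exists_norm_Gamma_le {A : ℝ} (hA : 0 < A) (B : ℝ) :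
    ∃ C : ℝ, 0 < C ∧ ∀ s : ℂ, A ≤ s.re → s.re ≤ B → 1 ≤ |s.im| →
      ‖Gamma s‖ ≤ C * |s.im| ^ s.re * Real.exp (-(Real.pi / 2 * |s.im|)) := by
  obtain ⟨C, hC0, hC⟩ := exists_Gamma_le_Icc hA B
  have hpi := Real.pi_gt_three
  refine ⟨Real.exp 1 * (Real.pi / 2) ^ B * C, by positivity, fun s hs1 hs2 ht => ?_⟩
  have hs : 0 < s.re := by linarith
  set t := |s.im| with htdef
  have ht0 : 0 < t := by linarith
  have hinv : 1 / t ≤ 1 := by rw [div_le_one ht0]; exact ht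
  have hinv0 : 0 < 1 / t := by positivity
  have key : ‖Gamma s‖ * Real.exp (Real.pi / 2 * t - 1) ≤
      (1 / Real.sin (1 / t)) ^ s.re * Real.Gamma s.re := by
    rcases le_total 0 s.im with h | h
    · have := norm_Gamma_mul_exp_le hs (θ := Real.pi / 2 - 1 / t)
        (by rw [abs_lt]; constructor <;> linarith)
      rw [Real.cos_pi_div_two_sub] at this
      have e : (Real.pi / 2 - 1 / t) * s.im = Real.pi / 2 * t - 1 := by
        rw [show s.im = t from (abs_of_nonneg h).symm]
        field_simp
      rwa [e] at this
    · have := norm_Gamma_mul_exp_le hs (θ := -(Real.pi / 2 - 1 / t))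
        (by rw [abs_lt]; constructor <;> linarith)
      rw [Real.cos_neg, Real.cos_pi_div_two_sub] at this
      have e : -(Real.pi / 2 - 1 / t) * s.im = Real.pi / 2 * t - 1 := by
        rw [show s.im = -t by rw [htdef, abs_of_nonpos h, neg_neg]]
        field_simp
      rwa [e] at this
  have hsin : 2 / Real.pi * (1 / t) ≤ Real.sin (1 / t) :=
    Real.mul_le_sin hinv0.le (by linarith)
  have h1 : 1 / Real.sin (1 / t) ≤ Real.pi / 2 * t := by
    calc 1 / Real.sin (1 / t) ≤ 1 / (2 / Real.pi * (1 / t)) :=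
          one_div_le_one_div_of_le (by positivity) hsin
      _ = Real.pi / 2 * t := by field_simp
  have hsin0 : 0 < Real.sin (1 / t) := lt_of_lt_of_le (by positivity) hsin
  have h2 : (1 / Real.sin (1 / t)) ^ s.re ≤ (Real.pi / 2) ^ B * t ^ s.re := by
    calc _ ≤ (Real.pi / 2 * t) ^ s.re := Real.rpow_le_rpow (by positivity) h1 hs.le
      _ = (Real.pi / 2) ^ s.re * t ^ s.re := Real.mul_rpow (by positivity) ht0.le
      _ ≤ _ := by
        gcongr
        linarith
  have h3 : ‖Gamma s‖ = ‖Gamma s‖ * Real.exp (Real.pi / 2 * t - 1) *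
      (Real.exp 1 * Real.exp (-(Real.pi / 2 * t))) := by
    rw [mul_assoc, ← Real.exp_add, ← Real.exp_add,
      show Real.pi / 2 * t - 1 + (1 + -(Real.pi / 2 * t)) = 0 by ring, Real.exp_zero, mul_one]
  rw [h3]
  calc _ ≤ ((Real.pi / 2) ^ B * t ^ s.re * C) *
        (Real.exp 1 * Real.exp (-(Real.pi / 2 * t))) := by
        refine mul_le_mul_of_nonneg_right (key.trans ?_) (by positivity)
        gcongr
        · exact hC _ ⟨hs1, hs2⟩
    _ = _ := by ring

theorem norm_sin_le_exp_abs_im (z : ℂ) : ‖Complex.sin z‖ ≤ Real.exp |z.im| := by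
  have h1 : ‖cexp (-z * I)‖ ≤ Real.exp |z.im| := by
    rw [Complex.norm_exp]
    exact Real.exp_le_exp.2 (by simpa using le_abs_self z.im)
  have h2 : ‖cexp (z * I)‖ ≤ Real.exp |z.im| := by
    rw [Complex.norm_exp]
    exact Real.exp_le_exp.2 (by simpa using neg_le_abs z.im)
  rw [Complex.sin, norm_div, norm_mul, Complex.norm_I, mul_one, Complex.norm_two]
  have := norm_sub_le (cexp (-z * I)) (cexp (z * I))
  linarith

/-- A lower bound for the Gamma function on vertical strips, sharp up to powers of `|Im s|`. -/
theorem exists_norm_inv_Gamma_le {A : ℝ} (hA : 2 ≤ A) (B : ℝ) :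
    ∃ C : ℝ, 0 < C ∧ ∀ s : ℂ, A ≤ s.re → s.re ≤ B → 1 ≤ |s.im| →
      ‖(Gamma s)⁻¹‖ ≤ C * |s.im|⁻¹ * Real.exp (Real.pi / 2 * |s.im|) := by
  -- By reflection it suffices to bound Γ(1 - s). Adding k > B puts the argument in the right half
  -- plane, and the extra power |Im s|^k in the upper bound is cancelled by the functional equation.
  obtain ⟨k, hk⟩ := exists_nat_gt B
  obtain ⟨C, hC0, hC⟩ := exists_norm_Gamma_le (A := 1 - B + k) (by linarith) (1 - A + k)
  have hpi := Real.pi_gt_three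
  refine ⟨C, hC0, fun s hs1 hs2 ht => ?_⟩
  set t := |s.im| with htdef
  have ht0 : 0 < t := by linarith
  have him : s.im ≠ 0 := abs_pos.1 ht0
  have h1im : |(1 - s).im| = t := by simp [htdef]
  have hG1 : ‖Gamma (1 - s)‖ ≤ C * t⁻¹ * Real.exp (-(Real.pi / 2 * t)) := by
    have h1 := norm_Gamma_mul_pow_abs_im_le (w := 1 - s) (Or.inr (by simpa using him)) k
    have h2 := hC (1 - s + k) (by simp; linarith) (by simp; linarith) (by simpa using ht)
    have h3 : |(1 - s + (k : ℂ)).im| = t := by simp [htdef]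
    have h4 : (1 - s + (k : ℂ)).re = (1 - s.re) + k := by simp
    rw [h1im] at h1
    rw [h3, h4, Real.rpow_add ht0, Real.rpow_natCast] at h2
    have h5 : t ^ (1 - s.re) ≤ t⁻¹ := by
      rw [← Real.rpow_neg_one]
      exact Real.rpow_le_rpow_of_exponent_le ht (by linarith)
    have h6 : ‖Gamma (1 - s)‖ * t ^ k ≤
        (C * t ^ (1 - s.re) * Real.exp (-(Real.pi / 2 * t))) * t ^ k :=
      (h1.trans h2).trans (le_of_eq (by ring))
    refine (le_of_mul_le_mul_right h6 (by positivity)).trans ?_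
    gcongr
  have hsin : Complex.sin (Real.pi * s) ≠ 0 := by
    rw [Ne, Complex.sin_eq_zero_iff]
    rintro ⟨n, hn⟩
    have h := congrArg Complex.im hn
    rw [Complex.im_ofReal_mul] at h
    have h' : Real.pi * s.im = 0 := by simpa using h
    exact him ((mul_eq_zero.1 h').resolve_left Real.pi_ne_zero)
  have hrefl := Complex.Gamma_mul_Gamma_one_sub s
  have hpi0 : (Real.pi : ℂ) ≠ 0 := by exact_mod_cast Real.pi_ne_zero
  have hinv : (Gamma s)⁻¹ = Gamma (1 - s) * Complex.sin (Real.pi * s) / Real.pi := by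
    have hG : Gamma s ≠ 0 := by
      intro h
      rw [h, zero_mul] at hrefl
      exact div_ne_zero hpi0 hsin hrefl.symm
    refine inv_eq_of_mul_eq_one_right ?_
    rw [← mul_div_assoc, ← mul_assoc, hrefl]
    field_simp
  have hs : ‖Complex.sin (Real.pi * s)‖ ≤ Real.exp (Real.pi * t) := by
    refine (norm_sin_le_exp_abs_im _).trans (le_of_eq ?_)
    simp [abs_mul, abs_of_pos Real.pi_pos, htdef]
  rw [hinv, norm_div, norm_mul, Complex.norm_real, Real.norm_of_nonneg (by positivity)]
  have hexp : Real.exp (-(Real.pi / 2 * t)) * Real.exp (Real.pi * t) =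
      Real.exp (Real.pi / 2 * t) := by rw [← Real.exp_add]; ring_nf
  calc _ ≤ (C * t⁻¹ * Real.exp (-(Real.pi / 2 * t))) * Real.exp (Real.pi * t) / Real.pi := by gcongr
    _ ≤ (C * t⁻¹ * Real.exp (-(Real.pi / 2 * t))) * Real.exp (Real.pi * t) :=
      div_le_self (by positivity) (by linarith)
    _ = _ := by rw [mul_assoc, hexp]

/-- The bound `exists_norm_inv_Gamma_le` for a shifted argument. -/
theorem exists_norm_inv_Gamma_add_le (c : ℂ) {A : ℝ} (hA : 2 ≤ A + c.re) (B : ℝ) :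
    ∃ C T : ℝ, 0 < C ∧ 1 ≤ T ∧ ∀ s : ℂ, A ≤ s.re → s.re ≤ B → T ≤ |s.im| →
      ‖(Gamma (s + c))⁻¹‖ ≤ C * |s.im|⁻¹ * Real.exp (Real.pi / 2 * |s.im|) := by
  obtain ⟨C, hC0, hC⟩ := exists_norm_inv_Gamma_le hA (B + c.re)
  have hpi := Real.pi_pos
  refine ⟨2 * C * Real.exp (Real.pi / 2 * |c.im|), 2 + 2 * |c.im|, by positivity,
    by linarith [abs_nonneg c.im], fun s hs1 hs2 ht => ?_⟩
  have h1 : |s.im| ≤ |(s + c).im| + |c.im| := by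
    have := abs_sub (s.im + c.im) c.im
    simpa using this
  have h2 : |(s + c).im| ≤ |s.im| + |c.im| := by simpa using abs_add_le s.im c.im
  have hs0 : 0 < |s.im| := by linarith [abs_nonneg c.im]
  have h3 : |s.im| / 2 ≤ |(s + c).im| := by linarith
  have h4 := hC (s + c) (by simpa using hs1) (by simpa using hs2)
    (by linarith [abs_nonneg c.im])
  refine h4.trans ?_
  calc C * |(s + c).im|⁻¹ * Real.exp (Real.pi / 2 * |(s + c).im|)
      ≤ C * (|s.im| / 2)⁻¹ * Real.exp (Real.pi / 2 * (|s.im| + |c.im|)) := by gcongr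
    _ = _ := by rw [mul_add, Real.exp_add]; field_simp

/-- Integrable decay of the Gamma function on vertical strips in the right half plane. -/
theorem norm_Gamma_le_div_one_add_sq {s : ℂ} (hs : 0 < s.re) :
    ‖Gamma s‖ ≤ (Real.Gamma s.re + Real.Gamma (s.re + 2)) * (1 + s.im ^ 2)⁻¹ := by
  rw [← div_eq_mul_inv, le_div_iff₀ (by positivity)]
  have h1 := norm_Gamma_le_of_re_pos hs
  have h2 := norm_Gamma_mul_pow_abs_im_le (Or.inl hs) 2
  have h3 := norm_Gamma_le_of_re_pos (a := s + (2 : ℕ)) (by simp; linarith)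
  rw [sq_abs] at h2
  simp at h3 h2
  linarith

/-! ### Periodic functions of subcritical growth -/

/-- A periodic entire function of growth `o(exp (2π Im s))` in the upper half plane has a limit
at `i∞`. -/
theorem exists_tendsto_comap_im_atTop_of_periodic {φ : ℂ → ℂ} (hd : Differentiable ℂ φ)
    (hper : Function.Periodic φ 1) {C T : ℝ}
    (hb : ∀ s : ℂ, T ≤ s.im → ‖φ s‖ ≤ C * |s.im|⁻¹ * Real.exp (2 * Real.pi * s.im)) :
    ∃ l, Tendsto φ (comap Complex.im atTop) (𝓝 l) := by
  have hper' : Function.Periodic φ ((1 : ℝ) : ℂ) := by simpa using hper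
  set g := Function.Periodic.cuspFunction 1 φ with hg
  have hgd : ∀ᶠ q in 𝓝[≠] (0 : ℂ), DifferentiableAt ℂ g q :=
    Function.Periodic.eventually_differentiableAt_cuspFunction_nhds_ne_zero one_pos hper'
      (Eventually.of_forall fun z => hd z)
  have hinv : Tendsto (fun q => (Function.Periodic.invQParam 1 q).im) (𝓝[≠] 0) atTop :=
    tendsto_comap_iff.1 (Function.Periodic.invQParam_tendsto one_pos)
  -- With q = exp(2πis), |q| cancels the exponential growth; the remaining |Im s|⁻¹ tends to 0, so
  -- the singularity at q = 0 is removable.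
  have hlim : Tendsto (fun q => q * g q) (𝓝[≠] 0) (𝓝 0) := by
    have h0 : Tendsto (fun q => C * |(Function.Periodic.invQParam 1 q).im|⁻¹) (𝓝[≠] 0) (𝓝 0) := by
      simpa using ((tendsto_inv_atTop_zero.comp (tendsto_abs_atTop_atTop.comp hinv)).const_mul C)
    refine squeeze_zero_norm' ?_ h0
    filter_upwards [self_mem_nhdsWithin, hinv.eventually_ge_atTop T] with q hq hT
    have hq : q ≠ 0 := hq
    rw [norm_mul, hg, Function.Periodic.cuspFunction_eq_of_nonzero _ _ hq]
    have hn : ‖q‖ = Real.exp (-(2 * Real.pi * (Function.Periodic.invQParam 1 q).im)) := by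
      conv_lhs => rw [← Function.Periodic.qParam_right_inv one_ne_zero hq]
      rw [Function.Periodic.norm_qParam]
      congr 1
      ring
    calc _ ≤ ‖q‖ * (C * |(Function.Periodic.invQParam 1 q).im|⁻¹ *
          Real.exp (2 * Real.pi * (Function.Periodic.invQParam 1 q).im)) := by
          gcongr
          exact hb _ hT
      _ = _ := by
        rw [hn, Real.exp_neg]
        field_simp
  have hlo : (fun q => g q - g 0) =o[𝓝[≠] 0] fun q => (q - 0)⁻¹ := by
    rw [Asymptotics.isLittleO_iff_tendsto']
    · have h1 : Tendsto (fun q : ℂ => q * g 0) (𝓝[≠] 0) (𝓝 0) :=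
        ((continuous_id.mul continuous_const).tendsto' 0 0 (by simp)).mono_left nhdsWithin_le_nhds
      have h2 := hlim.sub h1
      simp only [sub_zero] at h2
      refine h2.congr fun q => ?_
      rw [sub_zero, div_inv_eq_mul]
      ring
    · filter_upwards [self_mem_nhdsWithin] with q hq h
      have hq : q ≠ 0 := hq
      simp at h
      exact absurd h hq
  have hl := tendsto_limUnder_of_differentiable_on_punctured_nhds_of_isLittleO hgd hlo
  refine ⟨_, (hl.comp (Function.Periodic.qParam_tendsto one_pos)).congr fun z => ?_⟩
  exact Function.Periodic.eq_cuspFunction one_ne_zero hper' z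

/-- A periodic entire function of growth `o(exp (2π |Im s|))` is constant. -/
theorem eq_of_periodic_of_growth {φ : ℂ → ℂ} (hd : Differentiable ℂ φ)
    (hper : Function.Periodic φ 1) {C T : ℝ}
    (hb : ∀ s : ℂ, T ≤ |s.im| → ‖φ s‖ ≤ C * |s.im|⁻¹ * Real.exp (2 * Real.pi * |s.im|))
    (z w : ℂ) : φ z = φ w := by
  have aux : ∀ ψ : ℂ → ℂ, Differentiable ℂ ψ → Function.Periodic ψ 1 →
      (∀ s : ℂ, T ≤ |s.im| → ‖ψ s‖ ≤ C * |s.im|⁻¹ * Real.exp (2 * Real.pi * |s.im|)) →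
      ∃ K Y : ℝ, ∀ s : ℂ, Y ≤ s.im → ‖ψ s‖ ≤ K := by
    intro ψ hψd hψp hψb
    obtain ⟨l, hl⟩ := exists_tendsto_comap_im_atTop_of_periodic hψd hψp (C := C) (T := max T 0)
      (fun s hs => by
        have h0 : 0 ≤ s.im := (le_max_right _ _).trans hs
        have := hψb s (by rw [abs_of_nonneg h0]; exact (le_max_left _ _).trans hs)
        rwa [abs_of_nonneg h0] at this ⊢)
    have h1 : ∀ᶠ s in comap Complex.im atTop, ‖ψ s‖ ≤ ‖l‖ + 1 :=
      hl.norm.eventually_le_const (lt_add_one _)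
    obtain ⟨Y, hY⟩ := (atTop_basis.comap Complex.im).eventually_iff.1 h1
    exact ⟨_, Y, fun s hs => hY.2 hs⟩
  obtain ⟨K₁, Y₁, h₁⟩ := aux φ hd hper hb
  obtain ⟨K₂, Y₂, h₂⟩ := aux (fun s => φ (-s)) (hd.comp differentiable_neg)
    (fun s => by
      have := hper (-(s + 1))
      simp only at this ⊢
      rw [← this]
      ring_nf)
    (fun s hs => by simpa using hb (-s) (by simpa using hs))
  obtain ⟨K₃, h₃⟩ := ((isCompact_Icc (a := (0 : ℝ)) (b := 1)).reProdIm
    (isCompact_Icc (a := -Y₂) (b := Y₁))).exists_bound_of_continuousOn hd.continuous.continuousOn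
  refine hd.apply_eq_apply_of_bounded ?_ z w
  rw [isBounded_iff_forall_norm_le]
  refine ⟨max K₁ (max K₂ K₃), ?_⟩
  rintro _ ⟨s, rfl⟩
  by_cases hs1 : Y₁ ≤ s.im
  · exact (h₁ s hs1).trans (le_max_left _ _)
  by_cases hs2 : Y₂ ≤ -s.im
  · have := h₂ (-s) (by simpa using hs2)
    rw [neg_neg] at this
    exact this.trans ((le_max_left _ _).trans (le_max_right _ _))
  · have h4 : φ s = φ (s - (⌊s.re⌋ : ℂ)) := by
      have := hper.sub_int_mul_eq ⌊s.re⌋ (x := s)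
      simpa using this.symm
    rw [h4]
    refine (h₃ _ ?_).trans ((le_max_right _ _).trans (le_max_right _ _))
    rw [Complex.mem_reProdIm]
    push Not at hs1 hs2
    refine ⟨⟨?_, ?_⟩, ?_, ?_⟩
    · simp
    · simpa using (Int.fract_lt_one s.re).le
    · simp; linarith
    · simpa using hs1.le

/-- A holomorphic function on a right half plane, periodic there and of growth
`o(exp (2π |Im s|))` on a strip of width one, is constant. -/
theorem eq_of_periodic_halfPlane {φ : ℂ → ℂ} {R : ℝ}
    (hd : ∀ s : ℂ, R < s.re → DifferentiableAt ℂ φ s)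
    (hper : ∀ s : ℂ, R < s.re → φ (s + 1) = φ s) {R₁ C T : ℝ} (hR : R < R₁)
    (hb : ∀ s : ℂ, R₁ ≤ s.re → s.re ≤ R₁ + 1 → T ≤ |s.im| →
      ‖φ s‖ ≤ C * |s.im|⁻¹ * Real.exp (2 * Real.pi * |s.im|))
    {z w : ℂ} (hz : R < z.re) (hw : R < w.re) : φ z = φ w := by
  have hpern : ∀ (n : ℕ) (s : ℂ), R < s.re → φ (s + n) = φ s := by
    intro n
    induction n with
    | zero => simp
    | succ n ih =>
      intro s hs
      have hn : (0 : ℝ) ≤ n := Nat.cast_nonneg n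
      have : s + ((n + 1 : ℕ) : ℂ) = s + n + 1 := by push_cast; ring
      rw [this, hper _ (by simp; linarith), ih s hs]
  have hperz : ∀ (n : ℤ) (s : ℂ), R < s.re → R < (s + n).re → φ (s + n) = φ s := by
    intro n s hs hsn
    rcases Int.eq_nat_or_neg n with ⟨m, rfl | rfl⟩
    · simpa using hpern m s hs
    · have := hpern m (s + ((-(m : ℤ) : ℤ) : ℂ)) hsn
      rw [← this]
      congr 1
      push_cast
      ring
  -- Translating every point into the strip R₁ ≤ Re s ≤ R₁ + 1 extends φ to the plane. Near each
  -- point ψ is also a single translate of φ, so the jumps of the floor do no harm.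
  set ψ : ℂ → ℂ := fun s => φ (s - ((⌊s.re - R₁⌋ : ℤ) : ℂ)) with hψ
  have hmem : ∀ s : ℂ, R₁ ≤ (s - ((⌊s.re - R₁⌋ : ℤ) : ℂ)).re ∧
      (s - ((⌊s.re - R₁⌋ : ℤ) : ℂ)).re ≤ R₁ + 1 := by
    intro s
    have h1 := Int.floor_le (s.re - R₁)
    have h2 := Int.lt_floor_add_one (s.re - R₁)
    constructor <;> simp <;> linarith
  have hloc : ∀ (n : ℤ) (s : ℂ), R < (s + n).re → ψ s = φ (s + n) := by
    intro n s hs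
    have := hperz (n + ⌊s.re - R₁⌋) (s - ((⌊s.re - R₁⌋ : ℤ) : ℂ)) (hR.trans_le (hmem s).1)
      (by convert hs using 2; push_cast; ring)
    rw [hψ]
    simp only
    rw [← this]
    push_cast
    ring_nf
  have heq : ∀ s : ℂ, R < s.re → ψ s = φ s := fun s hs => by simpa using hloc 0 s (by simpa using hs)
  have hψd : Differentiable ℂ ψ := by
    intro s
    obtain ⟨n, hn⟩ := exists_int_gt (R - s.re)
    have hopen : {w : ℂ | R < (w + n).re} ∈ 𝓝 s :=
      (isOpen_lt continuous_const (Complex.continuous_re.comp (continuous_id.add continuous_const))).mem_nhds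
        (by simp; linarith)
    have h1 : DifferentiableAt ℂ (fun w : ℂ => φ (w + n)) s := by
      have := hd (s + n) (by simp; linarith)
      exact this.comp s (differentiableAt_id.add_const _)
    refine h1.congr_of_eventuallyEq ?_
    filter_upwards [hopen] with w hw using hloc n w hw
  have hψp : Function.Periodic ψ 1 := by
    intro s
    rw [hψ]
    simp only [Complex.add_re, Complex.one_re]
    have : s.re + 1 - R₁ = s.re - R₁ + 1 := by ring
    rw [this, Int.floor_add_one]
    push_cast
    ring_nf
  rw [← heq z hz, ← heq w hw]
  refine eq_of_periodic_of_growth hψd hψp (C := C) (T := T) (fun s hs => ?_) z w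
  have := hb _ (hmem s).1 (hmem s).2 (by simpa using hs)
  simpa using this

/-! ### Constant coefficient operators and the Laplace transform -/

/-- The constant coefficient operator `∂_e + c` on the plane. -/
def dirOp (e : ℝ × ℝ) (c : ℂ) (G : ℝ × ℝ → ℂ) : ℝ × ℝ → ℂ :=
  fun p => fderiv ℝ G p e + c * G p

/-- The exponential `exp (s₁ v + s₂ u)` at the point `(u, v)`. -/
def expWeight (s₁ s₂ : ℂ) (p : ℝ × ℝ) : ℂ := cexp (s₁ * p.2 + s₂ * p.1)

/-- The symbol of `∂_e` on `expWeight s₁ s₂`. -/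
def expSymbol (s₁ s₂ : ℂ) (e : ℝ × ℝ) : ℂ := s₁ * e.2 + s₂ * e.1

/-- The two-sided Laplace transform on the plane. -/
def laplace (H : ℝ × ℝ → ℂ) (s₁ s₂ : ℂ) : ℂ := ∫ p, H p * expWeight s₁ s₂ p

theorem contDiff_expWeight (s₁ s₂ : ℂ) {n : WithTop ℕ∞} : ContDiff ℝ n (expWeight s₁ s₂) := by
  have h1 : ContDiff ℝ n (fun p : ℝ × ℝ => (p.1 : ℂ)) := ofRealCLM.contDiff.comp contDiff_fst
  have h2 : ContDiff ℝ n (fun p : ℝ × ℝ => (p.2 : ℂ)) := ofRealCLM.contDiff.comp contDiff_snd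
  exact ((contDiff_const.mul h2).add (contDiff_const.mul h1)).cexp

theorem fderiv_expWeight (s₁ s₂ : ℂ) (p e : ℝ × ℝ) :
    fderiv ℝ (expWeight s₁ s₂) p e = expSymbol s₁ s₂ e * expWeight s₁ s₂ p := by
  have h1 : HasFDerivAt (fun p : ℝ × ℝ => (p.1 : ℂ))
      (ofRealCLM.comp (ContinuousLinearMap.fst ℝ ℝ ℝ)) p :=
    (ofRealCLM.comp (ContinuousLinearMap.fst ℝ ℝ ℝ)).hasFDerivAt
  have h2 : HasFDerivAt (fun p : ℝ × ℝ => (p.2 : ℂ))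
      (ofRealCLM.comp (ContinuousLinearMap.snd ℝ ℝ ℝ)) p :=
    (ofRealCLM.comp (ContinuousLinearMap.snd ℝ ℝ ℝ)).hasFDerivAt
  have h := ((h2.const_mul s₁).add (h1.const_mul s₂)).cexp
  have h' : HasFDerivAt (expWeight s₁ s₂) _ p := h
  rw [h'.fderiv]
  simp [expWeight, expSymbol]
  ring

theorem ContDiff.dirOp {n : WithTop ℕ∞} {G : ℝ × ℝ → ℂ} (hG : ContDiff ℝ (n + 1) G) (e : ℝ × ℝ)
    (c : ℂ) : ContDiff ℝ n (dirOp e c G) :=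
  ((hG.fderiv_right le_rfl).clm_apply contDiff_const).add
    (contDiff_const.mul (hG.of_le le_self_add))

theorem HasCompactSupport.dirOp {G : ℝ × ℝ → ℂ} (hG : HasCompactSupport G) (e : ℝ × ℝ)
    (c : ℂ) : HasCompactSupport (dirOp e c G) :=
  (hG.fderiv_apply (𝕜 := ℝ) e).add hG.mul_left

/-- Integration by parts for `∂_e + c`. -/
theorem integral_dirOp_mul {G ψ : ℝ × ℝ → ℂ} (hG : ContDiff ℝ 1 G) (hψ : ContDiff ℝ 1 ψ)
    (hs : HasCompactSupport ψ) (e : ℝ × ℝ) (c : ℂ) :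
    ∫ p, dirOp e c G p * ψ p = ∫ p, G p * dirOp (-e) c ψ p := by
  have hG' : Continuous (fun p => fderiv ℝ G p e) :=
    (hG.continuous_fderiv one_ne_zero).clm_apply continuous_const
  have hψ' : Continuous (fun p => fderiv ℝ ψ p e) :=
    (hψ.continuous_fderiv one_ne_zero).clm_apply continuous_const
  have i1 : Integrable (fun p => fderiv ℝ G p e * ψ p) :=
    (hG'.mul hψ.continuous).integrable_of_hasCompactSupport hs.mul_left
  have i2 : Integrable (fun p => G p * fderiv ℝ ψ p e) :=
    (hG.continuous.mul hψ').integrable_of_hasCompactSupport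
      (hs.fderiv_apply (𝕜 := ℝ) e).mul_left
  have i3 : Integrable (fun p => G p * ψ p) :=
    (hG.continuous.mul hψ.continuous).integrable_of_hasCompactSupport hs.mul_left
  have h := integral_mul_fderiv_eq_neg_fderiv_mul_of_integrable (v := e) i1 i2 i3
    (fun x _ => hG.differentiable one_ne_zero x) (fun x _ => hψ.differentiable one_ne_zero x)
  have e1 : ∀ p, dirOp e c G p * ψ p = fderiv ℝ G p e * ψ p + c * (G p * ψ p) := fun p => by
    simp only [dirOp]; ring
  have e2 : ∀ p, G p * dirOp (-e) c ψ p = -(G p * fderiv ℝ ψ p e) + c * (G p * ψ p) := fun p => by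
    simp only [dirOp, map_neg]; ring
  simp_rw [e1, e2]
  rw [integral_add i1 (i3.const_mul c),
    integral_add (f := fun p => -(G p * fderiv ℝ ψ p e)) i2.neg (i3.const_mul c), integral_neg, h,
    neg_neg]

/-- Conjugation by an exponential shifts the constant by the symbol. After integration by parts the
derivatives thus fall on the cut-off alone. -/
theorem dirOp_mul_expWeight {χ : ℝ × ℝ → ℂ} (hχ : Differentiable ℝ χ) (e : ℝ × ℝ) (c s₁ s₂ : ℂ) :
    dirOp e c (fun p => χ p * expWeight s₁ s₂ p) =
      fun p => dirOp e (c + expSymbol s₁ s₂ e) χ p * expWeight s₁ s₂ p := by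
  funext p
  have hE := (contDiff_expWeight s₁ s₂ (n := 1)).differentiable one_ne_zero
  simp only [dirOp]
  rw [fderiv_fun_mul (hχ p) (hE p)]
  simp only [add_apply, smul_apply, fderiv_expWeight,
    smul_eq_mul]
  ring

theorem dirOp_comp_smul {X : ℝ × ℝ → ℂ} (hX : Differentiable ℝ X) (e : ℝ × ℝ) (c : ℂ) (ε : ℝ) :
    dirOp e c (fun p => X (ε • p)) = fun p => dirOp (ε • e) c X (ε • p) := by
  funext p
  have h : HasFDerivAt (fun p : ℝ × ℝ => X (ε • p))
      ((fderiv ℝ X (ε • p)).comp (ε • ContinuousLinearMap.id ℝ (ℝ × ℝ))) p :=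
    (hX (ε • p)).hasFDerivAt.comp p (ε • ContinuousLinearMap.id ℝ (ℝ × ℝ)).hasFDerivAt
  simp only [dirOp]
  rw [h.fderiv]
  simp

theorem expSymbol_neg (s₁ s₂ : ℂ) (e : ℝ × ℝ) : expSymbol s₁ s₂ (-e) = -expSymbol s₁ s₂ e := by
  simp [expSymbol]; ring

/-- The expansion displays the power of ε on each derivative of the cut-off: as ε → 0 only the
product of the constants survives. -/
theorem dirOp_smul_dirOp_smul {X : ℝ × ℝ → ℂ} (hX : ContDiff ℝ 2 X) (e e' : ℝ × ℝ) (c c' : ℂ)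
    (ε : ℝ) (q : ℝ × ℝ) :
    dirOp (ε • e') c' (dirOp (ε • e) c X) q =
      (ε : ℂ) ^ 2 * fderiv ℝ (fun p => fderiv ℝ X p e) q e' + ε * (c * fderiv ℝ X q e') +
        ε * (c' * fderiv ℝ X q e) + c' * c * X q := by
  have hX1 : Differentiable ℝ X := hX.differentiable two_ne_zero
  have hX2 : Differentiable ℝ (fun p => fderiv ℝ X p e) :=
    (((hX.fderiv_right (m := 1) (by norm_num)).clm_apply contDiff_const).differentiable one_ne_zero)
  have h : dirOp (ε • e) c X = fun p => (ε : ℂ) * fderiv ℝ X p e + c * X p := by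
    funext p; simp [dirOp]
  rw [h]
  simp only [dirOp]
  have hd : HasFDerivAt (fun p => (ε : ℂ) * fderiv ℝ X p e + c * X p) _ q :=
    ((hX2 q).hasFDerivAt.const_mul (ε : ℂ)).add ((hX1 q).hasFDerivAt.const_mul c)
  rw [hd.fderiv]
  simp
  ring

/-- Testing a second order constant coefficient operator against dilated cut-offs of an
exponential computes, in the limit, the symbol of the operator times the Laplace transform. -/
theorem tendsto_integral_dirOp_dirOp_cutoff {H X : ℝ × ℝ → ℂ} (hH : ContDiff ℝ 2 H)
    (hX : ContDiff ℝ 2 X) (hXs : HasCompactSupport X) (hX0 : X 0 = 1) {s₁ s₂ : ℂ}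
    (hint : Integrable (fun p => H p * expWeight s₁ s₂ p)) (e e' : ℝ × ℝ) (c c' : ℂ) :
    Tendsto (fun n : ℕ => ∫ p, dirOp e c (dirOp e' c' H) p *
        (X ((1 / ((n : ℝ) + 1)) • p) * expWeight s₁ s₂ p)) atTop
      (𝓝 ((c - expSymbol s₁ s₂ e) * (c' - expSymbol s₁ s₂ e') * laplace H s₁ s₂)) := by
  set k := c - expSymbol s₁ s₂ e with hk
  set k' := c' - expSymbol s₁ s₂ e' with hk'
  set ε : ℕ → ℝ := fun n => 1 / ((n : ℝ) + 1) with hε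
  have hε0 : Tendsto ε atTop (𝓝 0) := tendsto_one_div_add_atTop_nhds_zero_nat
  have hε1 : ∀ n, 0 < ε n ∧ ε n ≤ 1 := fun n => by
    have : (0 : ℝ) ≤ n := Nat.cast_nonneg n
    refine ⟨by positivity, ?_⟩
    simp only [hε]
    rw [div_le_one (by positivity)]
    linarith
  have hE : ContDiff ℝ 2 (expWeight s₁ s₂) := contDiff_expWeight _ _
  -- Two integrations by parts leave H undifferentiated, so integrability of H times the exponential
  -- suffices for dominated convergence.
  have hrw : ∀ n, ∫ p, dirOp e c (dirOp e' c' H) p * (X (ε n • p) * expWeight s₁ s₂ p) =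
      ∫ p, dirOp (ε n • -e') k' (dirOp (ε n • -e) k X) (ε n • p) * (H p * expWeight s₁ s₂ p) := by
    intro n
    have hXn : ContDiff ℝ 2 (fun p => X (ε n • p)) := hX.comp (contDiff_const_smul _)
    have hXns : HasCompactSupport (fun p => X (ε n • p)) :=
      hXs.comp_homeomorph (Homeomorph.smulOfNeZero (ε n) (hε1 n).1.ne')
    have hD : ContDiff ℝ 1 (dirOp (-e) k (fun p => X (ε n • p))) :=
      ContDiff.dirOp (n := 1) (by exact_mod_cast hXn) _ _
    rw [integral_dirOp_mul (ContDiff.dirOp (n := 1) (by exact_mod_cast hH) _ _)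
        ((hXn.mul hE).of_le one_le_two) hXns.mul_right,
      dirOp_mul_expWeight (hXn.differentiable two_ne_zero), expSymbol_neg, ← sub_eq_add_neg, ← hk,
      integral_dirOp_mul (hH.of_le one_le_two) (hD.mul (hE.of_le one_le_two))
        ((HasCompactSupport.dirOp hXns _ _).mul_right),
      dirOp_mul_expWeight (hD.differentiable one_ne_zero), expSymbol_neg, ← sub_eq_add_neg, ← hk',
      dirOp_comp_smul (hX.differentiable two_ne_zero), dirOp_comp_smul
        ((ContDiff.dirOp (n := 1) (by exact_mod_cast hX) _ _).differentiable one_ne_zero)]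
    refine integral_congr_ae (Eventually.of_forall fun p => ?_)
    simp only
    ring
  have hX' : ∀ v, Continuous fun q => fderiv ℝ X q v := fun v =>
    (hX.continuous_fderiv two_ne_zero).clm_apply continuous_const
  have hX'' : Continuous fun q => fderiv ℝ (fun p => fderiv ℝ X p (-e)) q (-e') :=
    (((hX.fderiv_right (m := 1) (by norm_num)).clm_apply contDiff_const).continuous_fderiv
      one_ne_zero).clm_apply continuous_const
  have hX's : ∀ v, HasCompactSupport fun q => fderiv ℝ X q v := fun v => hXs.fderiv_apply (𝕜 := ℝ) v
  obtain ⟨B₀, hB₀⟩ := hXs.exists_bound_of_continuous hX.continuous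
  obtain ⟨B₁, hB₁⟩ := (hX's (-e)).exists_bound_of_continuous (hX' (-e))
  obtain ⟨B₂, hB₂⟩ := (hX's (-e')).exists_bound_of_continuous (hX' (-e'))
  obtain ⟨B₃, hB₃⟩ := ((hX's (-e)).fderiv_apply (𝕜 := ℝ) (-e')).exists_bound_of_continuous hX''
  simp_rw [dirOp_smul_dirOp_smul hX] at hrw
  change Tendsto (fun n : ℕ => ∫ p, dirOp e c (dirOp e' c' H) p *
        (X (ε n • p) * expWeight s₁ s₂ p)) atTop _
  simp_rw [hrw]
  rw [laplace, ← integral_const_mul]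
  refine tendsto_integral_of_dominated_convergence
    (fun p => (B₃ + ‖k‖ * B₂ + ‖k'‖ * B₁ + ‖k' * k‖ * B₀) * ‖H p * expWeight s₁ s₂ p‖) ?_
    (hint.norm.const_mul _) ?_ ?_
  · intro n
    refine AEStronglyMeasurable.mul (Continuous.aestronglyMeasurable ?_) hint.1
    have hs : Continuous fun p : ℝ × ℝ => ε n • p := continuous_const_smul _
    exact (((continuous_const.mul (hX''.comp hs)).add
      (continuous_const.mul (continuous_const.mul ((hX' _).comp hs)))).add
      (continuous_const.mul (continuous_const.mul ((hX' _).comp hs)))).add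
      (continuous_const.mul (hX.continuous.comp hs))
  · intro n
    refine Eventually.of_forall fun p => ?_
    rw [norm_mul]
    refine mul_le_mul_of_nonneg_right ?_ (norm_nonneg _)
    have hn : ‖(ε n : ℂ)‖ ≤ 1 := by
      rw [Complex.norm_real, Real.norm_of_nonneg (hε1 n).1.le]; exact (hε1 n).2
    refine norm_add_le_of_le (norm_add_le_of_le (norm_add_le_of_le ?_ ?_) ?_) ?_
    · rw [norm_mul, norm_pow]
      exact (mul_le_of_le_one_left (norm_nonneg _) (pow_le_one₀ (norm_nonneg _) hn)).trans (hB₃ _)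
    · rw [norm_mul, norm_mul]
      refine (mul_le_of_le_one_left (by positivity) hn).trans ?_
      gcongr
      exact hB₂ _
    · rw [norm_mul, norm_mul]
      refine (mul_le_of_le_one_left (by positivity) hn).trans ?_
      gcongr
      exact hB₁ _
    · rw [norm_mul]
      gcongr
      exact hB₀ _
  · refine Eventually.of_forall fun p => ?_
    have hεc : Tendsto (fun n => (ε n : ℂ)) atTop (𝓝 0) := by
      simpa [Function.comp_def] using (Complex.continuous_ofReal.tendsto 0).comp hε0
    have hεp : Tendsto (fun n => ε n • p) atTop (𝓝 0) := by
      simpa using hε0.smul_const p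
    have h1 := (hεc.pow 2).mul ((hX''.tendsto 0).comp hεp)
    have h2 := hεc.mul (((hX' (-e')).tendsto 0).comp hεp |>.const_mul k)
    have h3 := hεc.mul (((hX' (-e)).tendsto 0).comp hεp |>.const_mul k')
    have h4 := ((hX.continuous.tendsto 0).comp hεp).const_mul (k' * k)
    have h5 := (((h1.add h2).add h3).add h4).mul_const (H p * expWeight s₁ s₂ p)
    rw [hX0] at h5
    simp only [Function.comp_apply] at h5
    convert h5 using 2
    ring

theorem exists_cutoff : ∃ X : ℝ × ℝ → ℂ, ContDiff ℝ 2 X ∧ HasCompactSupport X ∧ X 0 = 1 := by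
  let b : ContDiffBump (0 : ℝ × ℝ) := ⟨1, 2, one_pos, one_lt_two⟩
  refine ⟨fun p => ((b p : ℝ) : ℂ), ofRealCLM.contDiff.comp b.contDiff, ?_, ?_⟩
  · exact b.hasCompactSupport.comp_left Complex.ofReal_zero
  · simp [b.eventuallyEq_one.eq_of_nhds]

/-! ### Logarithmic coordinates and the difference equations -/

/-- Logarithmic coordinates on the quadrant `x > 0`, `y < 0`. -/
def logCoord (q : ℝ × ℝ) : ℝ × ℝ := (Real.log q.1, Real.log (-q.2))

/-- The function `(u, v) ↦ f (e^u, -e^v)`. -/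
def expPull (f : ℝ × ℝ → ℂ) (p : ℝ × ℝ) : ℂ := f (Real.exp p.1, -Real.exp p.2)

theorem contDiff_expPull {f : ℝ × ℝ → ℂ} (hf : ContDiffOn ℝ 2 f quadrant) :
    ContDiff ℝ 2 (expPull f) := by
  have h : ContDiff ℝ 2 (fun p : ℝ × ℝ => (Real.exp p.1, -Real.exp p.2)) := by fun_prop
  refine contDiffOn_univ.1 (hf.comp h.contDiffOn fun p _ => ?_)
  exact ⟨Real.exp_pos _, neg_lt_zero.2 (Real.exp_pos _)⟩

theorem eqOn_expPull (f : ℝ × ℝ → ℂ) : EqOn f (expPull f ∘ logCoord) quadrant := by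
  rintro ⟨x, y⟩ ⟨hx, hy⟩
  have hy' : 0 < -y := neg_pos.2 hy
  simp only [expPull, logCoord, Function.comp_apply] at *
  rw [Real.exp_log hx, Real.exp_log hy', neg_neg]

theorem logCoord_exp (p : ℝ × ℝ) : logCoord (Real.exp p.1, -Real.exp p.2) = p := by
  simp [logCoord]

theorem exp_mem_quadrant (p : ℝ × ℝ) : (Real.exp p.1, -Real.exp p.2) ∈ quadrant :=
  ⟨Real.exp_pos _, neg_lt_zero.2 (Real.exp_pos _)⟩

/-- Since t d/dt = d/d(log t), this is the chain rule; equality on the quadrant is enough because it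
holds along the line near the point. -/
theorem thetaX_eq_fderiv {G g : ℝ × ℝ → ℂ} (hg : Differentiable ℝ g)
    (h : EqOn G (g ∘ logCoord) quadrant) {q : ℝ × ℝ} (hq : q ∈ quadrant) :
    thetaX G q = fderiv ℝ g (logCoord q) (1, 0) := by
  obtain ⟨x, y⟩ := q
  have hx : 0 < x := hq.1
  have hy : y < 0 := hq.2
  have h1 : (fun t : ℝ => G (t, y)) =ᶠ[𝓝 x] fun t => g (Real.log t, Real.log (-y)) := by
    filter_upwards [lt_mem_nhds hx] with t ht using h (x := (t, y)) ⟨ht, hy⟩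
  have h2 : HasDerivAt (fun t : ℝ => g (Real.log t, Real.log (-y)))
      (fderiv ℝ g (logCoord (x, y)) (x⁻¹, 0)) x :=
    (hg (logCoord (x, y))).hasFDerivAt.comp_hasDerivAt x
      ((Real.hasDerivAt_log hx.ne').prodMk (hasDerivAt_const x _))
  have h3 : ((x⁻¹, 0) : ℝ × ℝ) = x⁻¹ • (1, 0) := by simp
  simp only [thetaX]
  rw [h1.deriv_eq, h2.deriv, h3, map_smul, Complex.real_smul, ← mul_assoc, ← Complex.ofReal_mul,
    mul_inv_cancel₀ hx.ne', Complex.ofReal_one, one_mul]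

theorem thetaY_eq_fderiv {G g : ℝ × ℝ → ℂ} (hg : Differentiable ℝ g)
    (h : EqOn G (g ∘ logCoord) quadrant) {q : ℝ × ℝ} (hq : q ∈ quadrant) :
    thetaY G q = fderiv ℝ g (logCoord q) (0, 1) := by
  obtain ⟨x, y⟩ := q
  have hx : 0 < x := hq.1
  have hy : y < 0 := hq.2
  have h1 : (fun t : ℝ => G (x, t)) =ᶠ[𝓝 y] fun t => g (Real.log x, Real.log (-t)) := by
    filter_upwards [gt_mem_nhds hy] with t ht using h (x := (x, t)) ⟨hx, ht⟩
  have hlog : HasDerivAt (fun t : ℝ => Real.log (-t)) y⁻¹ y := by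
    simpa using Real.hasDerivAt_log hy.ne
  have h2 : HasDerivAt (fun t : ℝ => g (Real.log x, Real.log (-t)))
      (fderiv ℝ g (logCoord (x, y)) (0, y⁻¹)) y :=
    (hg (logCoord (x, y))).hasFDerivAt.comp_hasDerivAt y
      ((hasDerivAt_const y _).prodMk hlog)
  have h3 : ((0, y⁻¹) : ℝ × ℝ) = y⁻¹ • (0, 1) := by simp
  simp only [thetaY]
  rw [h1.deriv_eq, h2.deriv, h3, map_smul, Complex.real_smul, ← mul_assoc, ← Complex.ofReal_mul,
    mul_inv_cancel₀ hy.ne, Complex.ofReal_one, one_mul]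

theorem eqOn_opL {G g : ℝ × ℝ → ℂ} (hg : Differentiable ℝ g)
    (h : EqOn G (g ∘ logCoord) quadrant) (c : ℂ) :
    EqOn (opL c G) (dirOp (2, -1) c g ∘ logCoord) quadrant := by
  intro q hq
  have he : ((2, -1) : ℝ × ℝ) = (2 : ℝ) • (1, 0) - (0, 1) := by simp
  simp only [opL, dirOp, Function.comp_apply]
  rw [thetaX_eq_fderiv hg h hq, thetaY_eq_fderiv hg h hq, h hq, he, map_sub, map_smul]
  simp

theorem eqOn_opX {G g : ℝ × ℝ → ℂ} (hg : Differentiable ℝ g)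
    (h : EqOn G (g ∘ logCoord) quadrant) (c : ℂ) :
    EqOn (opX c G) (dirOp (1, 0) c g ∘ logCoord) quadrant := by
  intro q hq
  simp only [opX, dirOp, Function.comp_apply]
  rw [thetaX_eq_fderiv hg h hq, h hq]
  rfl

theorem IsSolution.expPull_eq_x {a d : ℂ} {f : ℝ × ℝ → ℂ} (hf : IsSolution a d quadrant f)
    (p : ℝ × ℝ) :
    (Real.exp p.1 : ℂ) * dirOp (2, -1) a (dirOp (2, -1) (a + 1) (expPull f)) p =
      dirOp (1, 0) 0 (dirOp (1, 0) (d - 1) (expPull f)) p := by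
  have hH := contDiff_expPull hf.contDiffOn
  have hd : Differentiable ℝ (expPull f) := hH.differentiable two_ne_zero
  have hd1 : ∀ e c, Differentiable ℝ (dirOp e c (expPull f)) := fun e c =>
    (ContDiff.dirOp (n := 1) (by exact_mod_cast hH) e c).differentiable one_ne_zero
  have hq := exp_mem_quadrant p
  have h := hf.eq_x _ hq
  rw [eqOn_opL (hd1 _ _) (eqOn_opL hd (eqOn_expPull f) _) a hq,
    thetaX_eq_fderiv (hd1 _ _) (eqOn_opX hd (eqOn_expPull f) _) hq, Function.comp_apply,
    logCoord_exp, sub_eq_zero] at h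
  rw [h]
  simp [dirOp]

theorem IsSolution.expPull_eq_y {a d : ℂ} {f : ℝ × ℝ → ℂ} (hf : IsSolution a d quadrant f)
    (p : ℝ × ℝ) :
    -(Real.exp p.2 : ℂ) * expPull f p =
      dirOp (0, 1) 0 (dirOp (2, -1) a (expPull f)) p := by
  have hH := contDiff_expPull hf.contDiffOn
  have hd : Differentiable ℝ (expPull f) := hH.differentiable two_ne_zero
  have hd1 : ∀ e c, Differentiable ℝ (dirOp e c (expPull f)) := fun e c =>
    (ContDiff.dirOp (n := 1) (by exact_mod_cast hH) e c).differentiable one_ne_zero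
  have hq := exp_mem_quadrant p
  have h := hf.eq_y _ hq
  rw [thetaY_eq_fderiv (hd1 _ _) (eqOn_opL hd (eqOn_expPull f) _) hq,
    logCoord_exp, sub_eq_zero] at h
  simp only [dirOp, expPull, zero_mul, add_zero] at h ⊢
  rw [← h]
  push_cast
  rfl

theorem expWeight_add_one_right (s₁ s₂ : ℂ) (p : ℝ × ℝ) :
    expWeight s₁ (s₂ + 1) p = Real.exp p.1 * expWeight s₁ s₂ p := by
  simp only [expWeight]
  rw [Complex.ofReal_exp, ← Complex.exp_add]
  ring_nf

theorem expWeight_add_one_left (s₁ s₂ : ℂ) (p : ℝ × ℝ) :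
    expWeight (s₁ + 1) s₂ p = Real.exp p.2 * expWeight s₁ s₂ p := by
  simp only [expWeight]
  rw [Complex.ofReal_exp, ← Complex.exp_add]
  ring_nf

/-- The recursion of the Laplace transform dual to the first equation. -/
theorem IsSolution.laplace_add_one_right {a d : ℂ} {f : ℝ × ℝ → ℂ} (hf : IsSolution a d quadrant f)
    {s₁ s₂ : ℂ} (h1 : Integrable (fun p => expPull f p * expWeight s₁ s₂ p))
    (h2 : Integrable (fun p => expPull f p * expWeight s₁ (s₂ + 1) p)) :
    (s₁ - 2 * s₂ + a - 1) * (s₁ - 2 * s₂ + a - 2) * laplace (expPull f) s₁ (s₂ + 1) =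
      s₂ * (s₂ - d + 1) * laplace (expPull f) s₁ s₂ := by
  have hH := contDiff_expPull hf.contDiffOn
  obtain ⟨X, hX, hXs, hX0⟩ := exists_cutoff
  have t1 := tendsto_integral_dirOp_dirOp_cutoff hH hX hXs hX0 h2 (2, -1) (2, -1) a (a + 1)
  have t2 := tendsto_integral_dirOp_dirOp_cutoff hH hX hXs hX0 h1 (1, 0) (1, 0) 0 (d - 1)
  have h := tendsto_nhds_unique (t1.congr fun n => integral_congr_ae
    (Eventually.of_forall fun p => ?_)) t2
  · simp only [expSymbol] at h
    push_cast at h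
    linear_combination h
  · rw [← hf.expPull_eq_x p, expWeight_add_one_right]
    ring

/-- The recursion of the Laplace transform dual to the second equation. -/
theorem IsSolution.laplace_add_one_left {a d : ℂ} {f : ℝ × ℝ → ℂ} (hf : IsSolution a d quadrant f)
    {s₁ s₂ : ℂ} (h1 : Integrable (fun p => expPull f p * expWeight s₁ s₂ p))
    (h2 : Integrable (fun p => expPull f p * expWeight (s₁ + 1) s₂ p)) :
    laplace (expPull f) (s₁ + 1) s₂ = s₁ * (s₁ - 2 * s₂ + a) * laplace (expPull f) s₁ s₂ := by
  have hH := contDiff_expPull hf.contDiffOn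
  obtain ⟨X, hX, hXs, hX0⟩ := exists_cutoff
  -- With direction 0 the operators are multiplication by -1 and by 1, so the zeroth-order side is
  -- covered by the same limit.
  have t1 := tendsto_integral_dirOp_dirOp_cutoff hH hX hXs hX0 h2 0 0 (-1) 1
  have t2 := tendsto_integral_dirOp_dirOp_cutoff hH hX hXs hX0 h1 (0, 1) (2, -1) 0 a
  have h := tendsto_nhds_unique (t1.congr fun n => integral_congr_ae
    (Eventually.of_forall fun p => ?_)) t2
  · simp only [expSymbol] at h
    simp at h
    linear_combination h
  · have h0 : ∀ (c : ℂ) (G : ℝ × ℝ → ℂ) q, dirOp 0 c G q = c * G q := fun c G q => by simp [dirOp]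
    simp only [h0]
    rw [← hf.expPull_eq_y p, expWeight_add_one_left]
    ring

/-! ### Exponential decay, holomorphy and boundedness of the transform -/

/-- Exponential decay of `H` after multiplication by `exp (σ₁ v + σ₂ u)`, for all
`σ₂ ≥ N`, `σ₁ ≥ 2 σ₂ + N`. -/
def ExpDecay (H : ℝ × ℝ → ℂ) (N : ℝ) : Prop :=
  ∀ σ₁ σ₂ : ℝ, N ≤ σ₂ → 2 * σ₂ + N ≤ σ₁ → ∃ K : ℝ, ∀ p : ℝ × ℝ,
    ‖H p‖ * Real.exp (σ₁ * p.2 + σ₂ * p.1) ≤ K * Real.exp (-|p.1| - |p.2|)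

theorem exp_mul_le_add {A B σ : ℝ} (hA : A ≤ σ) (hB : σ ≤ B) (v : ℝ) :
    Real.exp (σ * v) ≤ Real.exp (A * v) + Real.exp (B * v) := by
  rcases le_total 0 v with h | h
  · have : Real.exp (σ * v) ≤ Real.exp (B * v) := Real.exp_le_exp.2 (by gcongr)
    linarith [Real.exp_pos (A * v)]
  · have : Real.exp (σ * v) ≤ Real.exp (A * v) :=
      Real.exp_le_exp.2 (mul_le_mul_of_nonpos_right hA h)
    linarith [Real.exp_pos (B * v)]

/-- Domination by the four corners lets finitely many bounds control a whole rectangle of exponents.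
-/
theorem exp_add_le_corners {A₁ B₁ A₂ B₂ σ₁ σ₂ : ℝ} (h1 : A₁ ≤ σ₁) (h2 : σ₁ ≤ B₁) (h3 : A₂ ≤ σ₂)
    (h4 : σ₂ ≤ B₂) (p : ℝ × ℝ) :
    Real.exp (σ₁ * p.2 + σ₂ * p.1) ≤
      Real.exp (A₁ * p.2 + A₂ * p.1) + Real.exp (A₁ * p.2 + B₂ * p.1) +
        (Real.exp (B₁ * p.2 + A₂ * p.1) + Real.exp (B₁ * p.2 + B₂ * p.1)) := by
  simp only [Real.exp_add, ← mul_add, ← add_mul]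
  exact mul_le_mul (exp_mul_le_add h1 h2 _) (exp_mul_le_add h3 h4 _) (Real.exp_pos _).le
    (by positivity)

/-- The sign of each coordinate decides which unit shift of its exponent absorbs the absolute value,
so boundedness at shifted exponents yields exponential decay. -/
theorem exp_abs_add_abs_mul_le (σ₁ σ₂ : ℝ) (p : ℝ × ℝ) :
    Real.exp (|p.1| + |p.2|) * Real.exp (σ₁ * p.2 + σ₂ * p.1) ≤
      Real.exp ((σ₁ - 1) * p.2 + (σ₂ - 1) * p.1) + Real.exp ((σ₁ - 1) * p.2 + (σ₂ + 1) * p.1) +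
        (Real.exp ((σ₁ + 1) * p.2 + (σ₂ - 1) * p.1) +
          Real.exp ((σ₁ + 1) * p.2 + (σ₂ + 1) * p.1)) := by
  have key : ∀ σ v : ℝ, Real.exp |v| * Real.exp (σ * v) ≤
      Real.exp ((σ - 1) * v) + Real.exp ((σ + 1) * v) := by
    intro σ v
    rw [← Real.exp_add]
    rcases le_total 0 v with h | h
    · rw [abs_of_nonneg h, show v + σ * v = (σ + 1) * v by ring]
      linarith [Real.exp_pos ((σ - 1) * v)]
    · rw [abs_of_nonpos h, show -v + σ * v = (σ - 1) * v by ring]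
      linarith [Real.exp_pos ((σ + 1) * v)]
  simp only [Real.exp_add, ← mul_add, ← add_mul]
  calc _ = (Real.exp |p.2| * Real.exp (σ₁ * p.2)) * (Real.exp |p.1| * Real.exp (σ₂ * p.1)) := by
        ring
    _ ≤ _ := mul_le_mul (key _ _) (key _ _) (by positivity) (by positivity)

/-- Bounds at integer exponents pass to real ones through the corners of a unit square, and then to
decay through unit shifts. In the condition on σ₁ - 2σ₂, rounding costs 3, and the worst shift (σ₁ -
1, σ₂ + 1) costs another 3: hence N + 6. -/
theorem expDecay_expPull {f : ℝ × ℝ → ℂ} {N : ℕ} (hN : ∀ α₁ α₂ : ℕ, N ≤ α₂ → 2 * α₂ + N ≤ α₁ →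
      ∃ M : ℝ, ∀ x y : ℝ, 0 < x → 0 < y →
        ‖(y : ℂ) ^ α₁ * (x : ℂ) ^ α₂ * f (x, -y)‖ ≤ M) :
    ExpDecay (expPull f) (N + 6) := by
  have hnat : ∀ α₁ α₂ : ℕ, N ≤ α₂ → 2 * α₂ + N ≤ α₁ → ∃ M : ℝ, ∀ p : ℝ × ℝ,
      ‖expPull f p‖ * Real.exp (α₁ * p.2 + α₂ * p.1) ≤ M := by
    intro α₁ α₂ h1 h2
    obtain ⟨M, hM⟩ := hN α₁ α₂ h1 h2
    refine ⟨M, fun p => ?_⟩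
    have := hM _ _ (Real.exp_pos p.1) (Real.exp_pos p.2)
    rw [norm_mul, norm_mul, norm_pow, norm_pow, Complex.norm_real, Complex.norm_real,
      Real.norm_of_nonneg (Real.exp_pos _).le, Real.norm_of_nonneg (Real.exp_pos _).le,
      ← Real.exp_nat_mul, ← Real.exp_nat_mul, ← Real.exp_add, mul_comm] at this
    exact this
  have hreal : ∀ σ₁ σ₂ : ℝ, N ≤ σ₂ → 2 * σ₂ + N + 3 ≤ σ₁ → ∃ K : ℝ, ∀ p : ℝ × ℝ,
      ‖expPull f p‖ * Real.exp (σ₁ * p.2 + σ₂ * p.1) ≤ K := by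
    intro σ₁ σ₂ h1 h2
    have hN0 : (0 : ℝ) ≤ N := Nat.cast_nonneg N
    have hσ₂ : 0 ≤ σ₂ := hN0.trans h1
    have hσ₁ : 0 ≤ σ₁ := by linarith
    set n := ⌊σ₁⌋₊
    set m := ⌊σ₂⌋₊
    have hn1 : (n : ℝ) ≤ σ₁ := Nat.floor_le hσ₁
    have hn2 : σ₁ < n + 1 := Nat.lt_floor_add_one σ₁
    have hm1 : (m : ℝ) ≤ σ₂ := Nat.floor_le hσ₂
    have hm2 : σ₂ < m + 1 := Nat.lt_floor_add_one σ₂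
    have hNm : N ≤ m := Nat.le_floor h1
    have hnm : 2 * (m + 1) + N ≤ n := by
      have : (2 * ((m : ℝ) + 1) + N) < n := by linarith
      exact_mod_cast this.le
    obtain ⟨K₁, hK₁⟩ := hnat n m hNm (by omega)
    obtain ⟨K₂, hK₂⟩ := hnat n (m + 1) (by omega) (by omega)
    obtain ⟨K₃, hK₃⟩ := hnat (n + 1) m hNm (by omega)
    obtain ⟨K₄, hK₄⟩ := hnat (n + 1) (m + 1) (by omega) (by omega)
    refine ⟨K₁ + K₂ + (K₃ + K₄), fun p => ?_⟩
    refine (mul_le_mul_of_nonneg_left (exp_add_le_corners hn1 hn2.le hm1 hm2.le p)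
      (norm_nonneg _)).trans ?_
    have h1 := hK₁ p
    have h2 := hK₂ p
    have h3 := hK₃ p
    have h4 := hK₄ p
    push_cast at h1 h2 h3 h4
    rw [mul_add, mul_add, mul_add]
    exact add_le_add (add_le_add h1 h2) (add_le_add h3 h4)
  intro σ₁ σ₂ h1 h2
  obtain ⟨K₁, hK₁⟩ := hreal (σ₁ - 1) (σ₂ - 1) (by linarith) (by linarith)
  obtain ⟨K₂, hK₂⟩ := hreal (σ₁ - 1) (σ₂ + 1) (by linarith) (by linarith)
  obtain ⟨K₃, hK₃⟩ := hreal (σ₁ + 1) (σ₂ - 1) (by linarith) (by linarith)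
  obtain ⟨K₄, hK₄⟩ := hreal (σ₁ + 1) (σ₂ + 1) (by linarith) (by linarith)
  refine ⟨K₁ + K₂ + (K₃ + K₄), fun p => ?_⟩
  have h := mul_le_mul_of_nonneg_left (exp_abs_add_abs_mul_le σ₁ σ₂ p) (norm_nonneg (expPull f p))
  rw [mul_add, mul_add, mul_add] at h
  have h' := h.trans (add_le_add (add_le_add (hK₁ p) (hK₂ p)) (add_le_add (hK₃ p) (hK₄ p)))
  rw [show -|p.1| - |p.2| = -(|p.1| + |p.2|) by ring, Real.exp_neg, ← div_eq_mul_inv,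
    le_div_iff₀ (Real.exp_pos _)]
  linarith

theorem integrable_exp_neg_abs_half :
    Integrable (fun p : ℝ × ℝ => Real.exp (-(|p.1| + |p.2|) / 2)) := by
  have h1 : Integrable (fun x : ℝ => Real.exp (-(|x| / 2))) := by
    refine (integrable_inv_one_add_sq.const_mul 8).mono' (by fun_prop)
      (Eventually.of_forall fun x => ?_)
    rw [Real.norm_of_nonneg (Real.exp_pos _).le, Real.exp_neg, ← div_eq_mul_inv,
      inv_le_comm₀ (Real.exp_pos _) (by positivity)]
    have := Real.quadratic_le_exp_of_nonneg (x := |x| / 2) (by positivity)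
    have h2 : (|x| / 2) ^ 2 / 2 = x ^ 2 / 8 := by rw [div_pow, sq_abs]; ring
    rw [inv_div]
    have h3 := abs_nonneg x
    linarith
  refine (h1.mul_prod h1).congr (Eventually.of_forall fun p => ?_)
  simp only
  rw [← Real.exp_add]
  ring_nf

theorem norm_expWeight (s₁ s₂ : ℂ) (p : ℝ × ℝ) :
    ‖expWeight s₁ s₂ p‖ = Real.exp (s₁.re * p.2 + s₂.re * p.1) := by
  simp [expWeight, Complex.norm_exp]

theorem continuous_expWeight (s₁ s₂ : ℂ) : Continuous (expWeight s₁ s₂) :=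
  (contDiff_expWeight s₁ s₂ (n := 0)).continuous

theorem integrable_norm_mul_exp_half {H : ℝ × ℝ → ℂ} {N : ℝ} (hc : Continuous H) (hH : ExpDecay H N)
    {s₁ s₂ : ℂ} (h2 : N ≤ s₂.re) (h1 : 2 * s₂.re + N ≤ s₁.re) :
    Integrable (fun p : ℝ × ℝ => ‖H p * expWeight s₁ s₂ p‖ *
      Real.exp ((|p.1| + |p.2|) / 2)) := by
  obtain ⟨K, hK⟩ := hH s₁.re s₂.re h2 h1
  have hcE := continuous_expWeight s₁ s₂
  refine (integrable_exp_neg_abs_half.const_mul K).mono' (by fun_prop)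
    (Eventually.of_forall fun p => ?_)
  rw [Real.norm_of_nonneg (by positivity), norm_mul, norm_expWeight]
  calc _ ≤ K * Real.exp (-|p.1| - |p.2|) * Real.exp ((|p.1| + |p.2|) / 2) := by
        exact mul_le_mul_of_nonneg_right (hK p) (Real.exp_pos _).le
    _ = _ := by
        rw [mul_assoc, ← Real.exp_add]
        ring_nf

theorem integrable_mul_expWeight {H : ℝ × ℝ → ℂ} {N : ℝ} (hc : Continuous H) (hH : ExpDecay H N)
    {s₁ s₂ : ℂ} (h2 : N ≤ s₂.re) (h1 : 2 * s₂.re + N ≤ s₁.re) :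
    Integrable (fun p : ℝ × ℝ => H p * expWeight s₁ s₂ p) := by
  refine (integrable_norm_mul_exp_half hc hH h2 h1).mono
    (hc.mul (continuous_expWeight s₁ s₂)).aestronglyMeasurable (Eventually.of_forall fun p => ?_)
  rw [Real.norm_of_nonneg (by positivity)]
  exact le_mul_of_one_le_right (norm_nonneg _) (Real.one_le_exp (by positivity))

/-- Two kinds of line are used: s₁ varying with s₂ fixed, and s₁ = 2s₂ + const. Slopes of size at
most 2 cover both. -/
theorem differentiableAt_laplace_line {H : ℝ × ℝ → ℂ} {N : ℝ} (hc : Continuous H) (hH : ExpDecay H N)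
    {z : ℂ} {k₁ k₂ : ℝ} {b₁ b₂ : ℂ} (hk₁ : |k₁| ≤ 2)
    (hk₂ : |k₂| ≤ 2) (h2 : N ≤ (k₂ * z + b₂).re)
    (h1 : 2 * (k₂ * z + b₂).re + N ≤ (k₁ * z + b₁).re) :
    DifferentiableAt ℂ (fun z => laplace H (k₁ * z + b₁) (k₂ * z + b₂)) z := by
  have hsplit : ∀ (z : ℂ) (p : ℝ × ℝ), H p * expWeight (k₁ * z + b₁) (k₂ * z + b₂) p =
      H p * expWeight b₁ b₂ p * cexp (z * ((k₁ * p.2 + k₂ * p.1 : ℝ) : ℂ)) := by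
    intro z p
    rw [expWeight, expWeight, mul_assoc, ← Complex.exp_add]
    push_cast
    ring_nf
  simp only [laplace, hsplit]
  -- The exponent is at most 2(|u| + |v|), so ε = 1/4 uses exactly the spare factor exp((|u| +
  -- |v|)/2).
  refine differentiableAt_integral_mul_cexp (ε := 1 / 4) (by norm_num)
    (hc.mul (continuous_expWeight b₁ b₂)).aestronglyMeasurable
    (Continuous.aestronglyMeasurable (by fun_prop)) ?_
  have hint := integrable_norm_mul_exp_half hc hH h2 h1
  have hcE := continuous_expWeight b₁ b₂
  simp only [hsplit] at hint
  refine hint.mono (by fun_prop) (Eventually.of_forall fun p => ?_)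
  rw [Real.norm_of_nonneg (by positivity), Real.norm_of_nonneg (by positivity)]
  gcongr
  rw [Complex.norm_real, Real.norm_eq_abs]
  have h3 : |k₁ * p.2 + k₂ * p.1| ≤ 2 * |p.2| + 2 * |p.1| := by
    refine (abs_add_le _ _).trans ?_
    rw [abs_mul, abs_mul]
    gcongr
  linarith

/-- The sum of the four corner weights is one integrable majorant for the box; the critical corner
(A₁, B₂) dictates the hypothesis `h1`. -/
theorem exists_norm_laplace_le {H : ℝ × ℝ → ℂ} {N : ℝ} (hc : Continuous H) (hH : ExpDecay H N)
    {A₁ B₁ A₂ B₂ : ℝ} (h2 : N ≤ A₂) (h1 : 2 * B₂ + N ≤ A₁)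
    (hA₁ : A₁ ≤ B₁) (hA₂ : A₂ ≤ B₂) :
    ∃ K : ℝ, ∀ s₁ s₂ : ℂ, A₁ ≤ s₁.re → s₁.re ≤ B₁ → A₂ ≤ s₂.re → s₂.re ≤ B₂ →
      ‖laplace H s₁ s₂‖ ≤ K := by
  have hint : ∀ σ₁ σ₂ : ℝ, N ≤ σ₂ → 2 * σ₂ + N ≤ σ₁ →
      Integrable fun p : ℝ × ℝ => ‖H p‖ * Real.exp (σ₁ * p.2 + σ₂ * p.1) := by
    intro σ₁ σ₂ h h'
    refine (integrable_mul_expWeight hc hH (s₁ := σ₁) (s₂ := σ₂) h h').norm.congr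
      (Eventually.of_forall fun p => ?_)
    simp only [norm_mul, norm_expWeight, Complex.ofReal_re]
  have i1 := hint A₁ A₂ h2 (by linarith)
  have i2 := hint A₁ B₂ (by linarith) (by linarith)
  have i3 := hint B₁ A₂ h2 (by linarith)
  have i4 := hint B₁ B₂ (by linarith) (by linarith)
  refine ⟨_, fun s₁ s₂ a1 a2 a3 a4 => norm_integral_le_of_norm_le ((i1.add i2).add (i3.add i4))
    (Eventually.of_forall fun p => ?_)⟩
  rw [norm_mul, norm_expWeight]
  refine (mul_le_mul_of_nonneg_left (exp_add_le_corners a1 a2 a3 a4 p) (norm_nonneg _)).trans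
    (le_of_eq ?_)
  simp only [Pi.add_apply]
  ring

/-! ### Identification of the transform with the Gamma product -/

/-- A uniqueness theorem of Wielandt type for a product of two Gamma functions. -/
theorem exists_eq_const_mul_Gamma_mul_Gamma {F : ℂ → ℂ} {b c : ℂ} {R C T : ℝ}
    (hb : 2 ≤ R + b.re) (hc : 2 ≤ R + c.re)
    (hd : ∀ s : ℂ, R < s.re → DifferentiableAt ℂ F s)
    (hrec : ∀ s : ℂ, R < s.re → F (s + 1) = (s + b) * (s + c) * F s)
    (hbd : ∀ s : ℂ, R + 1 ≤ s.re → s.re ≤ R + 2 → T ≤ |s.im| →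
      ‖F s‖ ≤ C * Real.exp (Real.pi * |s.im|)) :
    ∃ k : ℂ, ∀ s : ℂ, R < s.re → F s = k * Gamma (s + b) * Gamma (s + c) := by
  have hne : ∀ e : ℂ, 2 ≤ R + e.re → ∀ s : ℂ, R < s.re → s + e ≠ 0 ∧ Gamma (s + e) ≠ 0 := by
    intro e he s hs
    have h0 : 0 < (s + e).re := by simp; linarith
    refine ⟨fun h => ?_, Gamma_ne_zero_of_re_pos h0⟩
    rw [h] at h0
    simp at h0
  set φ : ℂ → ℂ := fun s => F s * ((Gamma (s + b))⁻¹ * (Gamma (s + c))⁻¹) with hφ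
  obtain ⟨C₁, T₁, hC₁, hT₁, h₁⟩ := exists_norm_inv_Gamma_add_le b (A := R + 1) (by linarith) (R + 2)
  obtain ⟨C₂, T₂, hC₂, hT₂, h₂⟩ := exists_norm_inv_Gamma_add_le c (A := R + 1) (by linarith) (R + 2)
  have hconst : ∀ z w : ℂ, R < z.re → R < w.re → φ z = φ w := by
    intro z w hz hw
    refine eq_of_periodic_halfPlane (R := R) (R₁ := R + 1) (C := |C| * (C₁ * C₂))
      (T := max T (max T₁ T₂)) (fun s hs => ?_) (fun s hs => ?_) (by linarith)
      (fun s hs1 hs2 hs3 => ?_) hz hw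
    · have hG : ∀ e : ℂ, DifferentiableAt ℂ (fun s => (Gamma (s + e))⁻¹) s := fun e =>
        DifferentiableAt.comp (g := fun s => (Gamma s)⁻¹) (f := fun s => s + e) s
          (differentiable_one_div_Gamma (s + e)) (differentiableAt_id.add_const e)
      exact (hd s hs).mul ((hG b).mul (hG c))
    · obtain ⟨hb0, hbG⟩ := hne b hb s hs
      obtain ⟨hc0, hcG⟩ := hne c hc s hs
      simp only [hφ]
      rw [hrec s hs, show s + 1 + b = s + b + 1 by ring, show s + 1 + c = s + c + 1 by ring,
        Gamma_add_one _ hb0, Gamma_add_one _ hc0]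
      field_simp
    · have ht1 : T ≤ |s.im| := (le_max_left _ _).trans hs3
      have ht2 : T₁ ≤ |s.im| := ((le_max_left _ _).trans (le_max_right _ _)).trans hs3
      have ht3 : T₂ ≤ |s.im| := ((le_max_right _ _).trans (le_max_right _ _)).trans hs3
      have hs2' : s.re ≤ R + 2 := by linarith
      have ht0 : 1 ≤ |s.im| := hT₁.trans ht2
      -- F contributes rate π and each reciprocal Gamma π/2, which exhausts 2π. One factor |Im s|⁻¹
      -- makes the growth subcritical; the other is discarded.
      have hexp : Real.exp (2 * Real.pi * |s.im|) = Real.exp (Real.pi * |s.im|) *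
          (Real.exp (Real.pi / 2 * |s.im|) * Real.exp (Real.pi / 2 * |s.im|)) := by
        rw [← Real.exp_add, ← Real.exp_add]
        ring_nf
      simp only [hφ]
      rw [norm_mul, norm_mul]
      calc _ ≤ |C| * Real.exp (Real.pi * |s.im|) *
            ((C₁ * |s.im|⁻¹ * Real.exp (Real.pi / 2 * |s.im|)) *
              (C₂ * |s.im|⁻¹ * Real.exp (Real.pi / 2 * |s.im|))) := by
            gcongr
            · exact (hbd s hs1 hs2' ht1).trans (by gcongr; exact le_abs_self C)
            · exact h₁ s hs1 hs2' ht2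
            · exact h₂ s hs1 hs2' ht3
        _ = |C| * (C₁ * C₂) * |s.im|⁻¹ * Real.exp (2 * Real.pi * |s.im|) * |s.im|⁻¹ := by
            rw [hexp]; ring
        _ ≤ _ := mul_le_of_le_one_right (by positivity) (inv_le_one_of_one_le₀ ht0)
  refine ⟨φ ((R + 1 : ℝ) : ℂ), fun s hs => ?_⟩
  rw [hconst ((R + 1 : ℝ) : ℂ) s (by simp) hs]
  obtain ⟨hb0, hbG⟩ := hne b hb s hs
  obtain ⟨hc0, hcG⟩ := hne c hc s hs
  simp only [hφ]
  field_simp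

/-- The Laplace transform of an exponentially decaying solution is a multiple of the product of
Gamma functions in the Mellin–Barnes integrand. -/
theorem IsSolution.exists_laplace_eq {a d : ℂ} {f : ℝ × ℝ → ℂ} (hf : IsSolution a d quadrant f)
    {N : ℝ} (hH : ExpDecay (expPull f) N) :
    ∃ (C : ℂ) (R : ℝ), N ≤ R ∧ ∀ s₁ s₂ : ℂ, R < s₂.re → 2 * s₂.re + R < s₁.re →
      laplace (expPull f) s₁ s₂ =
        C * Gamma s₁ * Gamma (s₁ - 2 * s₂ + a) * Gamma s₂ * Gamma (s₂ - d + 1) := by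
  have hc : Continuous (expPull f) := (contDiff_expPull hf.contDiffOn).continuous
  set M := laplace (expPull f) with hM
  -- R₀ and R keep the real parts of all Gamma arguments at least 2, as the reciprocal bound
  -- requires.
  set R₀ : ℝ := max N (max 2 (2 - a.re)) with hR₀
  have hR₀N : N ≤ R₀ := le_max_left _ _
  have hR₀2 : 2 ≤ R₀ := (le_max_left _ _).trans (le_max_right _ _)
  have hR₀a : 2 - a.re ≤ R₀ := (le_max_right _ _).trans (le_max_right _ _)
  set R : ℝ := max R₀ (1 + d.re) with hR
  have hR0 : R₀ ≤ R := le_max_left _ _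
  have hRd : 1 + d.re ≤ R := le_max_right _ _
  set k₀ : ℝ := R₀ + 4 with hk₀
  -- On the line s₁ = 2s₂ + k₀ the factor Γ(s₁ - 2s₂ + a) is the constant Γ(k₀ + a), so c(s₂) is
  -- explicit and visibly holomorphic. The margin in k₀ lets a box of width 1 in Re s₂ stay in the
  -- region of convergence.
  set c : ℂ → ℂ := fun s => M (2 * s + k₀) s * (Gamma (2 * s + k₀))⁻¹ * (Gamma (k₀ + a))⁻¹ with hcdef
  have hGa : Gamma (k₀ + a) ≠ 0 := Gamma_ne_zero_of_re_pos (by simp; linarith)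
  -- For fixed s₂ the transform is bounded on strips in s₁, so the uniqueness theorem applies;
  -- evaluation at s₁ = 2s₂ + k₀ identifies its constant as c(s₂).
  have hstep : ∀ s₂ : ℂ, R < s₂.re → ∀ s₁ : ℂ, 2 * s₂.re + R₀ < s₁.re →
      M s₁ s₂ = c s₂ * Gamma s₁ * Gamma (s₁ - 2 * s₂ + a) := by
    intro s₂ hs₂
    obtain ⟨K, hK⟩ := exists_norm_laplace_le hc hH (A₁ := 2 * s₂.re + R₀ + 1)
      (B₁ := 2 * s₂.re + R₀ + 2) (A₂ := s₂.re) (B₂ := s₂.re) (by linarith) (by linarith)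
      (by linarith) le_rfl
    obtain ⟨k, hk⟩ := exists_eq_const_mul_Gamma_mul_Gamma (F := fun s => M s s₂) (b := 0)
      (c := a - 2 * s₂) (R := 2 * s₂.re + R₀) (C := |K|) (T := 0)
      (by simp; linarith) (by simp; linarith)
      (fun s hs => by
        have := differentiableAt_laplace_line hc hH (z := s) (k₁ := 1) (k₂ := 0) (b₁ := 0)
          (b₂ := s₂) (by norm_num) (by norm_num) (by simp; linarith) (by simp; linarith)
        simpa using this)
      (fun s hs => by
        have := hf.laplace_add_one_left (s₁ := s) (s₂ := s₂)
          (integrable_mul_expWeight hc hH (by linarith) (by linarith))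
          (integrable_mul_expWeight hc hH (by linarith) (by simp; linarith))
        simp only [hM]
        rw [this]
        ring)
      (fun s h1 h2 _ => by
        refine (hK s s₂ h1 h2 le_rfl le_rfl).trans ((le_abs_self K).trans ?_)
        exact le_mul_of_one_le_right (abs_nonneg K) (Real.one_le_exp (by positivity)))
    simp only [add_zero] at hk
    have hk1 := hk (2 * s₂ + k₀) (by simp; linarith)
    have hG1 : Gamma (2 * s₂ + k₀) ≠ 0 := Gamma_ne_zero_of_re_pos (by simp; linarith)
    have hck : c s₂ = k := by
      simp only [hcdef]
      rw [hk1, show 2 * s₂ + (k₀ : ℂ) + (a - 2 * s₂) = k₀ + a by ring]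
      field_simp
    intro s₁ hs₁
    rw [hck, hk s₁ hs₁, show s₁ + (a - 2 * s₂) = s₁ - 2 * s₂ + a by ring]
  obtain ⟨K, hK⟩ := exists_norm_laplace_le hc hH (A₁ := 2 * (R + 1) + k₀)
      (B₁ := 2 * (R + 2) + k₀) (A₂ := R + 1) (B₂ := R + 2) (by linarith) (by linarith)
      (by linarith) (by linarith)
  obtain ⟨C₁, hC₁, h₁⟩ := exists_norm_inv_Gamma_le (A := 2 * (R + 1) + k₀) (by linarith)
    (2 * (R + 2) + k₀)
  obtain ⟨C, hC⟩ := exists_eq_const_mul_Gamma_mul_Gamma (F := c) (b := 0) (c := 1 - d) (R := R)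
    (C := |K| * C₁ * ‖(Gamma (k₀ + a))⁻¹‖) (T := 1) (by simp; linarith) (by simp; linarith)
    (fun s hs => by
      have h1 := differentiableAt_laplace_line hc hH (z := s) (k₁ := 2) (k₂ := 1) (b₁ := k₀)
          (b₂ := 0) (by norm_num) (by norm_num) (by simp; linarith) (by simp; linarith)
      have h2 : DifferentiableAt ℂ (fun s : ℂ => (Gamma (2 * s + k₀))⁻¹) s :=
        DifferentiableAt.comp (g := fun s => (Gamma s)⁻¹) (f := fun s : ℂ => 2 * s + k₀) s
          (differentiable_one_div_Gamma (2 * s + k₀))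
          ((differentiableAt_id.const_mul 2).add_const (k₀ : ℂ))
      simp at h1
      exact (h1.mul h2).mul_const _)
    (fun s hs => by
      have hs' : R < (s + 1).re := by simp; linarith
      -- At s₁ = 2s + k₀ + 2 both s and s + 1 are admissible, with s₁ - 2s₂ equal to k₀ + 2 and k₀.
      -- The factor (k₀ + a)(k₀ + a + 1) cancels, leaving c(s + 1) = s(s - d + 1)c(s).
      have e1 := hstep s hs (2 * s + k₀ + 2) (by simp; linarith)
      have e2 := hstep (s + 1) hs' (2 * s + k₀ + 2) (by simp; linarith)
      have e3 := hf.laplace_add_one_right (s₁ := 2 * s + k₀ + 2) (s₂ := s)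
          (integrable_mul_expWeight hc hH (by linarith) (by simp; linarith))
          (integrable_mul_expWeight hc hH (by linarith) (by simp; linarith))
      have hre : 0 < (k₀ + a : ℂ).re := by simp; linarith
      have hw0 : (k₀ + a : ℂ) ≠ 0 := fun h => by rw [h] at hre; simp at hre
      have hw1 : (k₀ + a + 1 : ℂ) ≠ 0 := fun h => by
        have : (k₀ + a + 1 : ℂ).re = 0 := by rw [h]; simp
        simp at this hre
        linarith
      have hG1 : Gamma (2 * s + k₀ + 2) ≠ 0 := Gamma_ne_zero_of_re_pos (by simp; linarith)
      rw [show 2 * s + k₀ + 2 - 2 * s + a = k₀ + a + 1 + 1 by ring, Gamma_add_one _ hw1,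
        Gamma_add_one _ hw0] at e1
      rw [show 2 * s + k₀ + 2 - 2 * (s + 1) + a = k₀ + a by ring] at e2
      rw [← hM, e1, e2] at e3
      have hne : Gamma (2 * s + k₀ + 2) * Gamma (k₀ + a) * ((k₀ + a) * (k₀ + a + 1)) ≠ 0 :=
        mul_ne_zero (mul_ne_zero hG1 hGa) (mul_ne_zero hw0 hw1)
      refine mul_right_cancel₀ hne ?_
      linear_combination e3)
    (fun s h1 h2 h3 => by
      -- M is bounded here, and 1/Γ(2s + k₀) grows at rate (π/2)·2 = π, the most the uniqueness
      -- theorem allows.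
      have g1 := hK (2 * s + k₀) s (by simp; linarith) (by simp; linarith) h1 h2
      have g2 := h₁ (2 * s + k₀) (by simp; linarith) (by simp; linarith)
        (by simp [abs_mul]; linarith)
      have him : |(2 * s + (k₀ : ℂ)).im| = 2 * |s.im| := by simp [abs_mul]
      rw [him, show Real.pi / 2 * (2 * |s.im|) = Real.pi * |s.im| by ring] at g2
      have g3 : (2 * |s.im|)⁻¹ ≤ 1 := inv_le_one_of_one_le₀ (by linarith)
      simp only [hcdef]
      rw [norm_mul, norm_mul]
      calc _ ≤ |K| * (C₁ * 1 * Real.exp (Real.pi * |s.im|)) * ‖(Gamma (k₀ + a))⁻¹‖ := by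
            gcongr
            · exact g1.trans (le_abs_self K)
            · refine g2.trans ?_
              gcongr
        _ = _ := by ring)
  refine ⟨C, R, by linarith, fun s₁ s₂ h2 h1 => ?_⟩
  rw [hstep s₂ h2 s₁ (by linarith), hC s₂ h2]
  rw [add_zero, show s₂ + (1 - d) = s₂ - d + 1 by ring]
  ring

/-! ### Convergence of the Mellin–Barnes integral and shifting of contours -/

theorem vline_re (σ τ : ℝ) : (vline σ τ).re = σ := by simp [vline]

theorem vline_im (σ τ : ℝ) : (vline σ τ).im = τ := by simp [vline]

theorem continuous_vline (σ : ℝ) : Continuous (vline σ) := by unfold vline; fun_prop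

/-- Shifting a vertical line of integration. -/
theorem integral_vline_eq {G : ℂ → ℂ} {A B K : ℝ} (hAB : A ≤ B)
    (hd : ∀ s : ℂ, A ≤ s.re → s.re ≤ B → DifferentiableAt ℂ G s)
    (hb : ∀ s : ℂ, A ≤ s.re → s.re ≤ B → ‖G s‖ ≤ K * (1 + s.im ^ 2)⁻¹) :
    ∫ τ : ℝ, G (vline A τ) = ∫ τ : ℝ, G (vline B τ) := by
  have hcont : ∀ σ, A ≤ σ → σ ≤ B → Continuous fun τ : ℝ => G (vline σ τ) := fun σ h1 h2 =>
    continuous_iff_continuousAt.2 fun τ => ContinuousAt.comp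
      (hd _ (by rwa [vline_re]) (by rwa [vline_re])).continuousAt (continuous_vline σ).continuousAt
  have hint : ∀ σ, A ≤ σ → σ ≤ B → Integrable fun τ : ℝ => G (vline σ τ) := fun σ h1 h2 =>
    (integrable_inv_one_add_sq.const_mul K).mono' (hcont σ h1 h2).aestronglyMeasurable
      (Eventually.of_forall fun τ => by
        simpa [vline_im] using hb (vline σ τ) (by rwa [vline_re]) (by rwa [vline_re]))
  have hlim : ∀ σ, A ≤ σ → σ ≤ B → Tendsto (fun T : ℝ => ∫ τ in -T..T, G (vline σ τ)) atTop
      (𝓝 (∫ τ : ℝ, G (vline σ τ))) := fun σ h1 h2 =>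
    intervalIntegral_tendsto_integral (hint σ h1 h2) tendsto_neg_atTop_atBot tendsto_id
  -- Cauchy's theorem on a rectangle of height 2T: the difference of the vertical sides equals the
  -- horizontal ones, which are O(T⁻²).
  have hrect : ∀ T : ℝ, (∫ τ in -T..T, G (vline B τ)) - (∫ τ in -T..T, G (vline A τ)) =
      I * ((∫ x in A..B, G (vline x (-T))) - ∫ x in A..B, G (vline x T)) := by
    intro T
    have h := integral_boundary_rect_eq_zero_of_differentiableOn G (vline A (-T)) (vline B T)
      (fun s hs => by
        rw [Complex.mem_reProdIm, vline_re, vline_re, uIcc_of_le hAB] at hs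
        exact (hd s hs.1.1 hs.1.2).differentiableWithinAt)
    simp only [vline_re, vline_im, smul_eq_mul] at h
    simp only [vline] at h ⊢
    linear_combination (-I) * h + ((∫ τ : ℝ in -T..T, G (B + τ * I)) -
      ∫ τ : ℝ in -T..T, G (A + τ * I)) * I_sq
  have hsmall : ∀ T : ℝ, ‖I * ((∫ x in A..B, G (vline x (-T))) - ∫ x in A..B, G (vline x T))‖ ≤
      2 * (K * (B - A)) * (1 + T ^ 2)⁻¹ := by
    intro T
    have h1 : ∀ t : ℝ, ‖∫ x in A..B, G (vline x t)‖ ≤ K * (1 + t ^ 2)⁻¹ * |B - A| := fun t =>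
      intervalIntegral.norm_integral_le_of_norm_le_const fun x hx => by
        rw [uIoc_of_le hAB] at hx
        simpa [vline_im] using hb (vline x t) (by rw [vline_re]; exact hx.1.le)
          (by rw [vline_re]; exact hx.2)
    have h2 := h1 (-T)
    have h3 := h1 T
    rw [abs_of_nonneg (sub_nonneg.2 hAB)] at h2 h3
    rw [norm_mul, Complex.norm_I, one_mul]
    refine (norm_sub_le _ _).trans ((add_le_add h2 h3).trans (le_of_eq ?_))
    rw [neg_sq]
    ring
  have hzero : Tendsto (fun T : ℝ => (∫ τ in -T..T, G (vline B τ)) - ∫ τ in -T..T, G (vline A τ))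
      atTop (𝓝 0) := by
    have h0 : Tendsto (fun T : ℝ => 2 * (K * (B - A)) * (1 + T ^ 2)⁻¹) atTop (𝓝 0) := by
      have : Tendsto (fun T : ℝ => 1 + T ^ 2) atTop atTop :=
        tendsto_atTop_add_const_left _ _ (tendsto_pow_atTop two_ne_zero)
      simpa using (tendsto_inv_atTop_zero.comp this).const_mul (2 * (K * (B - A)))
    refine squeeze_zero_norm (fun T => ?_) h0
    rw [hrect]
    exact hsmall T
  have h := tendsto_nhds_unique hzero ((hlim B hAB le_rfl).sub (hlim A le_rfl hAB))
  exact (sub_eq_zero.1 h.symm).symm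

/-- The product of Gamma functions in the Mellin–Barnes integrand. -/
def gammaKernel (a d s₁ s₂ : ℂ) : ℂ :=
  Gamma s₁ * Gamma (s₁ - 2 * s₂ + a) * Gamma s₂ * Gamma (s₂ - d + 1)

theorem mellinBarnesIntegrand_eq (a d : ℂ) {x y : ℝ} (hx : 0 < x) (hy : y < 0) (s₁ s₂ : ℂ) :
    mellinBarnesIntegrand a d x y s₁ s₂ =
      gammaKernel a d s₁ s₂ * expWeight (-s₁) (-s₂) (logCoord (x, y)) := by
  have hy' : 0 < -y := neg_pos.2 hy
  have h1 : ((-y : ℝ) : ℂ) ≠ 0 := by exact_mod_cast hy'.ne'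
  have h2 : (x : ℂ) ≠ 0 := by exact_mod_cast hx.ne'
  rw [mellinBarnesIntegrand, gammaKernel, expWeight, Complex.cpow_def_of_ne_zero h1,
    Complex.cpow_def_of_ne_zero h2, mul_assoc _ (cexp _), ← Complex.exp_add, logCoord,
    Complex.ofReal_log hx.le, Complex.ofReal_log hy'.le]
  ring_nf

/-- The open cone of admissible real parts. -/
def InCone (a d : ℂ) (σ₁ σ₂ : ℝ) : Prop :=
  0 < σ₁ ∧ 0 < σ₂ ∧ (d - 1).re < σ₂ ∧ -a.re < σ₁ - 2 * σ₂

theorem exists_norm_Gamma_le_div {A : ℝ} (hA : 0 < A) (B : ℝ) :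
    ∃ C : ℝ, 0 < C ∧ ∀ s : ℂ, A ≤ s.re → s.re ≤ B →
      ‖Gamma s‖ ≤ C ∧ ‖Gamma s‖ ≤ C * (1 + s.im ^ 2)⁻¹ := by
  obtain ⟨C₁, h1, hC₁⟩ := exists_Gamma_le_Icc hA B
  obtain ⟨C₂, h2, hC₂⟩ := exists_Gamma_le_Icc (A := A + 2) (by linarith) (B + 2)
  have key : ∀ s : ℂ, A ≤ s.re → s.re ≤ B → ‖Gamma s‖ ≤ (C₁ + C₂) * (1 + s.im ^ 2)⁻¹ := by
    intro s hs1 hs2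
    refine (norm_Gamma_le_div_one_add_sq (hA.trans_le hs1)).trans ?_
    gcongr
    · exact hC₁ _ ⟨hs1, hs2⟩
    · exact hC₂ _ ⟨by linarith, by linarith⟩
  refine ⟨C₁ + C₂, by positivity, fun s hs1 hs2 => ⟨(key s hs1 hs2).trans ?_, key s hs1 hs2⟩⟩
  exact mul_le_of_le_one_right (by positivity)
    (inv_le_one_of_one_le₀ (by linarith [sq_nonneg s.im]))

/-- Quadratic decay of Γ(s₁) and Γ(s₂) already gives an integrable product majorant, so the other
two Gamma factors need only be bounded. -/
theorem exists_norm_integrand_le {a d : ℂ} {A₁ B₁ A₂ B₂ : ℝ} (h1 : 0 < A₁) (h2 : 0 < A₂)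
    (h3 : (d - 1).re < A₂) (h4 : -a.re < A₁ - 2 * B₂) (p : ℝ × ℝ) :
    ∃ K : ℝ, ∀ s₁ s₂ : ℂ, A₁ ≤ s₁.re → s₁.re ≤ B₁ → A₂ ≤ s₂.re → s₂.re ≤ B₂ →
      ‖gammaKernel a d s₁ s₂ * expWeight (-s₁) (-s₂) p‖ ≤
        K * ((1 + s₁.im ^ 2)⁻¹ * (1 + s₂.im ^ 2)⁻¹) := by
  simp only [sub_re, one_re] at h3
  obtain ⟨C₁, hC₁, g1⟩ := exists_norm_Gamma_le_div h1 B₁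
  obtain ⟨C₂, hC₂, g2⟩ := exists_norm_Gamma_le_div h2 B₂
  obtain ⟨C₃, hC₃, g3⟩ := exists_norm_Gamma_le_div (A := A₂ - d.re + 1) (by linarith)
    (B₂ - d.re + 1)
  obtain ⟨C₄, hC₄, g4⟩ := exists_norm_Gamma_le_div (A := A₁ - 2 * B₂ + a.re) (by linarith)
    (B₁ - 2 * A₂ + a.re)
  set W := Real.exp (-B₁ * p.2 + -B₂ * p.1) + Real.exp (-B₁ * p.2 + -A₂ * p.1) +
        (Real.exp (-A₁ * p.2 + -B₂ * p.1) + Real.exp (-A₁ * p.2 + -A₂ * p.1)) with hW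
  refine ⟨C₁ * C₄ * C₂ * C₃ * W, fun s₁ s₂ a1 a2 a3 a4 => ?_⟩
  rw [gammaKernel, norm_mul, norm_mul, norm_mul, norm_mul, norm_expWeight]
  have e1 := (g1 s₁ a1 a2).2
  have e2 := (g2 s₂ a3 a4).2
  have e3 := (g3 (s₂ - d + 1) (by simp; linarith) (by simp; linarith)).1
  have e4 := (g4 (s₁ - 2 * s₂ + a) (by simp; linarith) (by simp; linarith)).1
  have e5 := exp_add_le_corners (A₁ := -B₁) (B₁ := -A₁) (A₂ := -B₂) (B₂ := -A₂)
    (σ₁ := (-s₁).re) (σ₂ := (-s₂).re) (by simpa using a2) (by simpa using a1)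
    (by simpa using a4) (by simpa using a3) p
  calc _ ≤ (C₁ * (1 + s₁.im ^ 2)⁻¹) * C₄ * (C₂ * (1 + s₂.im ^ 2)⁻¹) * C₃ * W := by gcongr
    _ = _ := by ring

theorem differentiableAt_Gamma_of_re_pos {s : ℂ} (hs : 0 < s.re) : DifferentiableAt ℂ Gamma s :=
  differentiableAt_Gamma s fun m h => by
    have : s.re = -(m : ℝ) := by rw [h]; simp
    have h0 : (0 : ℝ) ≤ m := Nat.cast_nonneg m
    linarith

theorem differentiableAt_integrand {a d : ℂ} {α β : ℂ → ℂ} {z : ℂ} (hα : DifferentiableAt ℂ α z)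
    (hβ : DifferentiableAt ℂ β z) (h : InCone a d (α z).re (β z).re) (p : ℝ × ℝ) :
    DifferentiableAt ℂ (fun z => gammaKernel a d (α z) (β z) * expWeight (-α z) (-β z) p) z := by
  obtain ⟨h1, h2, h3, h4⟩ := h
  simp only [sub_re, one_re] at h3
  have hG : ∀ γ : ℂ → ℂ, DifferentiableAt ℂ γ z → 0 < (γ z).re →
      DifferentiableAt ℂ (fun z => Gamma (γ z)) z := fun γ hγ h0 =>
    (differentiableAt_Gamma_of_re_pos h0).comp z hγ
  refine DifferentiableAt.mul ((((hG α hα h1).mul (hG _ ((hα.sub (hβ.const_mul 2)).add_const a)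
    (by simp; linarith))).mul (hG β hβ h2)).mul
    (hG _ ((hβ.sub_const d).add_const 1) (by simp; linarith))) ?_
  exact ((hα.neg.mul_const _).add (hβ.neg.mul_const _)).cexp

theorem continuous_integrand_vline {a d : ℂ} {σ₁ σ₂ : ℝ} (h : InCone a d σ₁ σ₂) (p : ℝ × ℝ) :
    Continuous fun τ : ℝ × ℝ => gammaKernel a d (vline σ₁ τ.1) (vline σ₂ τ.2) *
      expWeight (-vline σ₁ τ.1) (-vline σ₂ τ.2) p := by
  obtain ⟨h1, h2, h3, h4⟩ := h
  simp only [sub_re, one_re] at h3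
  have c1 : Continuous fun τ : ℝ × ℝ => vline σ₁ τ.1 := (continuous_vline σ₁).comp continuous_fst
  have c2 : Continuous fun τ : ℝ × ℝ => vline σ₂ τ.2 := (continuous_vline σ₂).comp continuous_snd
  have hG : ∀ γ : ℝ × ℝ → ℂ, Continuous γ → (∀ τ, 0 < (γ τ).re) →
      Continuous (fun τ => Gamma (γ τ)) := fun γ hγ h0 =>
    continuous_iff_continuousAt.2 fun τ => ContinuousAt.comp (f := γ)
      (differentiableAt_Gamma_of_re_pos (h0 τ)).continuousAt hγ.continuousAt
  refine Continuous.mul ((((hG _ c1 fun τ => by rwa [vline_re]).mul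
    (hG _ ((c1.sub (c2.const_mul 2)).add_const a) fun τ => by simp [vline_re]; linarith)).mul
    (hG _ c2 fun τ => by rwa [vline_re])).mul
    (hG _ ((c2.sub continuous_const).add_const 1) fun τ => by simp [vline_re]; linarith)) ?_
  exact Complex.continuous_exp.comp ((c1.neg.mul_const _).add (c2.neg.mul_const _))

theorem integrable_integrand {a d : ℂ} {σ₁ σ₂ : ℝ} (h : InCone a d σ₁ σ₂) (p : ℝ × ℝ) :
    Integrable fun τ : ℝ × ℝ => gammaKernel a d (vline σ₁ τ.1) (vline σ₂ τ.2) *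
      expWeight (-vline σ₁ τ.1) (-vline σ₂ τ.2) p := by
  have hcont := continuous_integrand_vline h p
  obtain ⟨h1, h2, h3, h4⟩ := h
  obtain ⟨K, hK⟩ := exists_norm_integrand_le (B₁ := σ₁) (B₂ := σ₂) h1 h2 h3 h4 p
  refine ((integrable_inv_one_add_sq.mul_prod integrable_inv_one_add_sq).const_mul K).mono'
    hcont.aestronglyMeasurable (Eventually.of_forall fun τ => ?_)
  have := hK (vline σ₁ τ.1) (vline σ₂ τ.2) (by rw [vline_re]) (by rw [vline_re]) (by rw [vline_re])
    (by rw [vline_re])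
  simpa only [vline_im] using this

/-- The integral of the Mellin–Barnes integrand over a pair of vertical lines, in logarithmic
coordinates. -/
def lineIntegral (a d : ℂ) (p : ℝ × ℝ) (σ₁ σ₂ : ℝ) : ℂ :=
  ∫ τ : ℝ × ℝ, gammaKernel a d (vline σ₁ τ.1) (vline σ₂ τ.2) *
    expWeight (-vline σ₁ τ.1) (-vline σ₂ τ.2) p

/-- Raising σ₁ never leaves the cone, so no condition on the target line is needed. Fubini makes s₁
the inner variable. -/
theorem lineIntegral_shift_left {a d : ℂ} {σ₁ σ₁' σ₂ : ℝ} (h : InCone a d σ₁ σ₂) (hle : σ₁ ≤ σ₁')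
    (p : ℝ × ℝ) : lineIntegral a d p σ₁ σ₂ = lineIntegral a d p σ₁' σ₂ := by
  obtain ⟨h1, h2, h3, h4⟩ := h
  have h' : ∀ σ, σ₁ ≤ σ → InCone a d σ σ₂ := fun σ hσ => ⟨by linarith, h2, h3, by linarith⟩
  rw [lineIntegral, lineIntegral, Measure.volume_eq_prod,
    integral_prod_symm _ (integrable_integrand (h' _ le_rfl) p),
    integral_prod_symm _ (integrable_integrand (h' _ hle) p)]
  obtain ⟨K, hK⟩ := exists_norm_integrand_le (B₁ := σ₁') (B₂ := σ₂) h1 h2 h3 h4 p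
  refine integral_congr_ae (Eventually.of_forall fun τ₂ => ?_)
  refine integral_vline_eq (G := fun s => gammaKernel a d s (vline σ₂ τ₂) *
    expWeight (-s) (-vline σ₂ τ₂) p) (K := K * (1 + τ₂ ^ 2)⁻¹) hle (fun s hs _ => ?_)
    (fun s hs hs' => ?_)
  · exact differentiableAt_integrand (α := fun s => s) (β := fun _ => vline σ₂ τ₂)
      differentiableAt_id (differentiableAt_const _) (by simpa only [vline_re] using h' _ hs) p
  · have := hK s (vline σ₂ τ₂) hs hs' (by rw [vline_re]) (by rw [vline_re])
    rw [vline_im] at this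
    exact this.trans (le_of_eq (by ring))

/-- Raising σ₂ lowers σ₁ - 2σ₂, so the target must be assumed in the cone; the intermediate lines
then lie in it too. -/
theorem lineIntegral_shift_right {a d : ℂ} {σ₁ σ₂ σ₂' : ℝ} (h : InCone a d σ₁ σ₂)
    (h' : InCone a d σ₁ σ₂') (hle : σ₂ ≤ σ₂') (p : ℝ × ℝ) :
    lineIntegral a d p σ₁ σ₂ = lineIntegral a d p σ₁ σ₂' := by
  rw [lineIntegral, lineIntegral, Measure.volume_eq_prod,
    integral_prod _ (integrable_integrand h p), integral_prod _ (integrable_integrand h' p)]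
  obtain ⟨h1, h2, h3, h4⟩ := h
  obtain ⟨-, -, -, h4'⟩ := h'
  obtain ⟨K, hK⟩ := exists_norm_integrand_le (B₁ := σ₁) (B₂ := σ₂') h1 h2 h3 h4' p
  refine integral_congr_ae (Eventually.of_forall fun τ₁ => ?_)
  refine integral_vline_eq (G := fun s => gammaKernel a d (vline σ₁ τ₁) s *
    expWeight (-vline σ₁ τ₁) (-s) p) (K := K * (1 + τ₁ ^ 2)⁻¹) hle (fun s hs hs' => ?_)
    (fun s hs hs' => ?_)
  · refine differentiableAt_integrand (α := fun _ => vline σ₁ τ₁) (β := fun s => s)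
      (differentiableAt_const _) differentiableAt_id ?_ p
    simp only [vline_re]
    exact ⟨h1, by linarith, by linarith, by linarith⟩
  · have := hK (vline σ₁ τ₁) s (by rw [vline_re]) (by rw [vline_re]) hs hs'
    rw [vline_im] at this
    exact this.trans (le_of_eq (by ring))

/-- The Mellin–Barnes integral does not depend on the lines of integration. -/
theorem lineIntegral_eq {a d : ℂ} {σ₁ σ₂ σ₁' σ₂' : ℝ} (h : InCone a d σ₁ σ₂)
    (h' : InCone a d σ₁' σ₂') (p : ℝ × ℝ) :
    lineIntegral a d p σ₁ σ₂ = lineIntegral a d p σ₁' σ₂' := by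
  wlog hle : σ₂ ≤ σ₂' generalizing σ₁ σ₂ σ₁' σ₂'
  · exact (this h' h (le_of_not_ge hle)).symm
  -- Both first lines are moved to their common maximum, after which only σ₂ has to change.
  have e1 : σ₁ ≤ max σ₁ σ₁' := le_max_left _ _
  have e2 : σ₁' ≤ max σ₁ σ₁' := le_max_right _ _
  rw [lineIntegral_shift_left h e1, lineIntegral_shift_left h' e2]
  obtain ⟨h1, h2, h3, h4⟩ := h
  obtain ⟨h1', h2', h3', h4'⟩ := h'
  exact lineIntegral_shift_right ⟨by linarith, h2, h3, by linarith⟩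
    ⟨by linarith, h2', h3', by linarith⟩ hle p

/-! ### Laplace inversion -/

/-- Fourier inversion on the plane `ℝ × ℝ`. -/
theorem eq_integral_fourier_prod {k : ℝ × ℝ → ℂ} (hk : Continuous k) (hint : Integrable k)
    {F : ℝ × ℝ → ℂ} (hF : ∀ w : ℝ × ℝ,
      ∫ p : ℝ × ℝ, cexp (((-2 * Real.pi * (w.1 * p.1 + w.2 * p.2) : ℝ) : ℂ) * I) * k p = F w)
    (hFint : Integrable F) (p : ℝ × ℝ) :
    k p = ∫ w : ℝ × ℝ, cexp (((2 * Real.pi * (p.1 * w.1 + p.2 * w.2) : ℝ) : ℂ) * I) * F w := by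
  have hmp : MeasurePreserving (MeasurableEquiv.toLp 2 (ℝ × ℝ)).symm volume volume :=
    WithLp.volume_preserving_symm_measurableEquiv_toLp_prod ℝ ℝ
  set k' : WithLp 2 (ℝ × ℝ) → ℂ := fun q => k q.ofLp with hk'
  have hk'c : Continuous k' := hk.comp (WithLp.prod_continuous_ofLp 2 ℝ ℝ)
  have hk'i : Integrable k' := hmp.integrable_comp_of_integrable hint
  have hfour : FourierTransform.fourier k' = fun w : WithLp 2 (ℝ × ℝ) => F w.ofLp := by
    funext w
    rw [Real.fourier_eq', ← hF, ← hmp.integral_comp']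
    refine integral_congr_ae (Eventually.of_forall fun q => ?_)
    simp only [WithLp.prod_inner_apply, smul_eq_mul, hk']
    rfl
  have hfi : Integrable (FourierTransform.fourier k') := by
    rw [hfour]
    exact hmp.integrable_comp_of_integrable hFint
  have hinv := congrFun (hk'c.fourierInv_fourier_eq hk'i hfi) (WithLp.toLp 2 p)
  rw [hfour, Real.fourierInv_eq'] at hinv
  rw [← hmp.integral_comp']
  refine hinv.symm.trans (integral_congr_ae (Eventually.of_forall fun q => ?_))
  simp only [WithLp.prod_inner_apply, smul_eq_mul]
  rfl

/-- Laplace inversion, along a pair of vertical lines, for the product of Gamma functions. -/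
theorem eq_mul_lineIntegral_of_laplace_eq {a d C : ℂ} {H : ℝ × ℝ → ℂ} {σ₁ σ₂ : ℝ}
    (hH : Continuous H) (hint : Integrable fun p => H p * expWeight σ₁ σ₂ p)
    (hcone : InCone a d σ₁ σ₂)
    (hL : ∀ τ₁ τ₂ : ℝ, laplace H (vline σ₁ τ₁) (vline σ₂ τ₂) =
      C * gammaKernel a d (vline σ₁ τ₁) (vline σ₂ τ₂)) (p : ℝ × ℝ) :
    H p = C * (((2 * Real.pi) ^ 2 : ℝ) : ℂ)⁻¹ * lineIntegral a d p σ₁ σ₂ := by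
  set r : ℝ := -2 * Real.pi with hr
  have hr0 : r ≠ 0 := by
    rw [hr]
    have := Real.pi_pos
    exact (mul_neg_of_neg_of_pos (by norm_num) this).ne
  set Φ : ℝ × ℝ → ℝ × ℝ → ℂ := fun p τ => gammaKernel a d (vline σ₁ τ.1) (vline σ₂ τ.2) *
    expWeight (-vline σ₁ τ.1) (-vline σ₂ τ.2) p with hΦ
  -- The frequency is τ = -2πw. The swap is needed because s₁ is dual to v, the second coordinate,
  -- and s₂ to u, the first.
  have hF : ∀ w : ℝ × ℝ, ∫ p : ℝ × ℝ, cexp (((-2 * Real.pi * (w.1 * p.1 + w.2 * p.2) : ℝ) : ℂ) * I) *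
      (H p * expWeight σ₁ σ₂ p) = C * Φ 0 (r • w).swap := by
    intro w
    have h0 : Φ 0 (r • w).swap =
        gammaKernel a d (vline σ₁ (r * w.2)) (vline σ₂ (r * w.1)) := by
      simp [hΦ, expWeight]
    rw [h0, ← hL, laplace]
    refine integral_congr_ae (Eventually.of_forall fun p => ?_)
    simp only [expWeight, vline]
    rw [mul_left_comm, ← Complex.exp_add]
    congr 2
    rw [hr]
    push_cast
    ring
  have hFint : Integrable fun w : ℝ × ℝ => C * Φ 0 (r • w).swap := by
    have h1 : Integrable fun w : ℝ × ℝ => Φ 0 w.swap := (integrable_integrand hcone 0).swap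
    exact (h1.comp_smul hr0).const_mul C
  have hinv := eq_integral_fourier_prod (hH.mul (continuous_expWeight σ₁ σ₂)) hint hF hFint p
  have hE : expWeight σ₁ σ₂ p ≠ 0 := Complex.exp_ne_zero _
  refine mul_right_cancel₀ hE (hinv.trans ?_)
  have hpt : ∀ w : ℝ × ℝ, cexp (((2 * Real.pi * (p.1 * w.1 + p.2 * w.2) : ℝ) : ℂ) * I) *
      (C * Φ 0 (r • w).swap) = C * expWeight σ₁ σ₂ p * Φ p (r • w).swap := by
    intro w
    have h1 : expWeight (-vline σ₁ (r * w.2)) (-vline σ₂ (r * w.1)) 0 = 1 := by simp [expWeight]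
    have h2 : cexp (((2 * Real.pi * (p.1 * w.1 + p.2 * w.2) : ℝ) : ℂ) * I) =
        expWeight σ₁ σ₂ p * expWeight (-vline σ₁ (r * w.2)) (-vline σ₂ (r * w.1)) p := by
      simp only [expWeight, vline]
      rw [← Complex.exp_add]
      congr 1
      rw [hr]
      push_cast
      ring
    simp only [hΦ, Prod.fst_swap, Prod.snd_swap, Prod.smul_fst, Prod.smul_snd, smul_eq_mul]
    rw [h1, h2]
    ring
  simp_rw [hpt]
  rw [integral_const_mul, Measure.integral_comp_smul volume (fun w : ℝ × ℝ => Φ p w.swap) r,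
    Measure.volume_eq_prod, integral_prod_swap, ← Measure.volume_eq_prod]
  have hfin : Module.finrank ℝ (ℝ × ℝ) = 2 := by simp
  have habs : |(r ^ 2)⁻¹| = ((2 * Real.pi) ^ 2)⁻¹ := by
    rw [abs_of_nonneg (by positivity), hr]
    ring_nf
  rw [hfin, habs, Complex.real_smul, lineIntegral]
  push_cast
  ring

end HornH10

end

/-! ### Conclusion -/

open HornH10 in
theorem mainTheorem9 (a d : ℂ) (f : ℝ × ℝ → ℂ)
    (hf : HornH10.IsSolution a d HornH10.quadrant f)
    (hgrowth : ∃ N : ℕ, ∀ α₁ α₂ : ℕ, N ≤ α₂ → 2 * α₂ + N ≤ α₁ →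
      ∃ M : ℝ, ∀ x y : ℝ, 0 < x → 0 < y →
        ‖(y : ℂ) ^ α₁ * (x : ℂ) ^ α₂ * f (x, -y)‖ ≤ M) :
    ∃ C : ℂ, ∀ σ₁ σ₂ : ℝ, 0 < σ₁ → max 0 (d - 1).re < σ₂ → -a.re < σ₁ - 2 * σ₂ →
      ∀ x y : ℝ, 0 < x → y < 0 →
        HornH10.VerticalIntegrable (HornH10.mellinBarnesIntegrand a d x y) σ₁ σ₂ ∧
        f (x, y) =
          C * HornH10.verticalIntegral (HornH10.mellinBarnesIntegrand a d x y) σ₁ σ₂ := by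
  obtain ⟨N, hN⟩ := hgrowth
  have hH := expDecay_expPull hN
  have hc : Continuous (expPull f) := (contDiff_expPull hf.contDiffOn).continuous
  obtain ⟨C, R, hNR, hL⟩ := hf.exists_laplace_eq hH
  -- The lines ρ₁, ρ₂ lie both in the cone and where the transform is known; inversion is carried
  -- out there.
  set ρ₂ : ℝ := max (R + 1) (max 1 ((d - 1).re + 1)) with hρ₂
  have hρR : R + 1 ≤ ρ₂ := le_max_left _ _
  have hρ1 : 1 ≤ ρ₂ := (le_max_left _ _).trans (le_max_right _ _)
  have hρd : (d - 1).re + 1 ≤ ρ₂ := (le_max_right _ _).trans (le_max_right _ _)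
  set ρ₁ : ℝ := 2 * ρ₂ + max (R + 1) (max 1 (-a.re + 1)) with hρ₁
  have hρ₁R : 2 * ρ₂ + (R + 1) ≤ ρ₁ := by rw [hρ₁]; gcongr; exact le_max_left _ _
  have hρ₁1 : 2 * ρ₂ + 1 ≤ ρ₁ := by
    rw [hρ₁]; gcongr; exact (le_max_left _ _).trans (le_max_right _ _)
  have hρ₁a : 2 * ρ₂ + (-a.re + 1) ≤ ρ₁ := by
    rw [hρ₁]; gcongr; exact (le_max_right _ _).trans (le_max_right _ _)
  have hcone : InCone a d ρ₁ ρ₂ := ⟨by linarith, by linarith, by linarith, by linarith⟩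
  have hrepr := eq_mul_lineIntegral_of_laplace_eq (C := C) hc
    (integrable_mul_expWeight hc hH (s₁ := ρ₁) (s₂ := ρ₂) (by simp; linarith)
      (by simp; linarith)) hcone
    (fun τ₁ τ₂ => by
      rw [hL _ _ (by rw [vline_re]; linarith) (by rw [vline_re, vline_re]; linarith), gammaKernel]
      ring)
  -- The factor (2π)⁻² comes from inversion, and the minus sign offsets i² = -1 from ds₁ ds₂.
  refine ⟨-(C * (((2 * Real.pi) ^ 2 : ℝ) : ℂ)⁻¹), fun σ₁ σ₂ h1 h2 h3 x y hx hy => ?_⟩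
  have hσ : InCone a d σ₁ σ₂ :=
    ⟨h1, (le_max_left _ _).trans_lt h2, (le_max_right _ _).trans_lt h2, h3⟩
  constructor
  · simp only [VerticalIntegrable, mellinBarnesIntegrand_eq a d hx hy]
    exact integrable_integrand hσ _
  · have hfx : f (x, y) = expPull f (logCoord (x, y)) := eqOn_expPull f ⟨hx, hy⟩
    rw [hfx, hrepr, lineIntegral_eq hcone hσ]
    simp only [verticalIntegral, mellinBarnesIntegrand_eq a d hx hy, lineIntegral, Complex.I_sq]
    ring
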